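/- Fix $0<\rho<1$. Let $\{\omega_x : x\in\mathbb Z_{\ge0}^2\setminus\{0\}\}$ be mutually independent exponential random variables: $\omega_{ie_1}\sim\mathrm{Exp}(1-\rho)$ and $\omega_{je_2}\sim\mathrm{Exp}(\rho)$ for $i,j\ge1$ on the two coordinate axes, and $\omega_x\sim\mathrm{Exp}(1)$ for $x\in\mathbb Z_{>0}^2$ (the parameter is the rate). For a real number $N>0$ put \[ (m,n)=\bigl(\lfloor N(1-\rho)^2\rfloor,\ \lfloor N\rho^2\rfloor\bigr), \] and let $\pi^{0,(m,n)}=(\pi_k)_{k=0}^{m+n}$ be the (almost surely unique) maximizing path, or geodesic, from $0$ to $(m,n)$, that is, the lattice path with $\pi_0=0$, $\pi_{m+n}=(m,n)$ and steps in $\{e_1,e_2\}$ which maximizes $\sum_{k=1}^{m+n}\omega_{\pi_k}$ among all such paths. For $x\in\mathbb R^2$ and $s\ge0$ let $A_s(x)=\{y\in\mathbb R^2: x_i\le y_i\le x_i+s,\ i=1,2\}$. (a) There is a finite constant $C=C(\rho)>0$ such that for every $0<\delta<1$, every real $r\ge1$ and every real $N\ge 1/\delta$, \[ \sup_{0\le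 t\le 1-\delta} \mathbb P\bigl\{\pi^{0,(m,n)}\text{ does not intersect }A_{rN^{2/3}}(tm,tn)\bigr\}\le \frac{C}{r^3}. \] (b) There are constants $\delta=\delta(\rho)>0$ and $\varepsilon=\varepsilon(\rho)>0$ such that for every $0<t<1$ there is $N_0=N_0(\rho,t)<\infty$ with \[ \mathbb P\bigl\{\pi^{0,(m,n)}\text{ does not intersect }A_{\delta(1-t)^{2/3}N^{2/3}}(tm,tn)\bigr\}\ge\varepsilon \qquad\text{for all real } N\ge N_0. \] In particular, for each fixed $0<t<1$ there are $\delta',\varepsilon>0$ such that the geodesic misses $A_{\delta' N^{2/3}}(tm,tn)$ with probability at least $\varepsilon$ for all large $N$. -/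

import Mathlib

open MeasureTheory ProbabilityTheory

noncomputable section

namespace StationaryCGM

/-- Rate of the exponential weight at the vertex `x ≠ 0` of the quadrant: `1 - ρ` on the
horizontal axis (the weights `I`), `ρ` on the vertical axis (the weights `J`), `1` in the bulk. -/
def weightRate (ρ : ℝ) (x : ℕ × ℕ) : ℝ :=
  if x.2 = 0 then 1 - ρ else if x.1 = 0 then ρ else 1

/-- `w` is the family of weights of the increment-stationary exponential corner growth model with
parameter `ρ`: the random variables `w x`, `x ≠ 0`, are mutually independent and exponentially
distributed with the rates above. There is no condition at the corner `0`, whose weight is not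
used. -/
structure IsWeightFamily {Ω : Type*} [MeasurableSpace Ω] (P : Measure Ω) (ρ : ℝ)
    (w : ℕ × ℕ → Ω → ℝ) : Prop where
  measurable : ∀ x, x ≠ 0 → Measurable (w x)
  law : ∀ x, x ≠ 0 → P.map (w x) = expMeasure (weightRate ρ x)
  indep : iIndepFun (fun x : {x : ℕ × ℕ // x ≠ 0} => w x) P

/-- `(π 0, …, π (m + n))` is an up-right lattice path from `0` to `(m, n)`. The values `π k` with
`k > m + n` play no role. -/
def IsUpRightPath (m n : ℕ) (π : ℕ → ℕ × ℕ) : Prop :=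
  π 0 = (0, 0) ∧ π (m + n) = (m, n) ∧
    ∀ k < m + n, π (k + 1) = π k + (1, 0) ∨ π (k + 1) = π k + (0, 1)

/-- The total weight `∑_{k=1}^{m+n} w (π k)` collected by a path after it leaves the corner. -/
def passageTime (w : ℕ × ℕ → ℝ) (m n : ℕ) (π : ℕ → ℕ × ℕ) : ℝ :=
  ∑ k ∈ Finset.Icc 1 (m + n), w (π k)

/-- `π` is a maximizing path (geodesic) from `0` to `(m, n)`: its weight is the last-passage
value, the maximum of the weights of all up-right paths from `0` to `(m, n)`. -/
def IsGeodesic (w : ℕ × ℕ → ℝ) (m n : ℕ) (π : ℕ → ℕ × ℕ) : Prop :=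
  IsUpRightPath m n π ∧
    ∀ π', IsUpRightPath m n π' → passageTime w m n π' ≤ passageTime w m n π

/-- The closed square `A_s(x)` with side length `s` and lower left corner `x`. -/
def square (s : ℝ) (x : ℝ × ℝ) : Set (ℝ × ℝ) :=
  {y | (x.1 ≤ y.1 ∧ y.1 ≤ x.1 + s) ∧ (x.2 ≤ y.2 ∧ y.2 ≤ x.2 + s)}

/-- The path `(π 0, …, π (m + n))` does not intersect the set `A`. -/
def Misses (m n : ℕ) (π : ℕ → ℕ × ℕ) (A : Set (ℝ × ℝ)) : Prop :=
  ∀ k ≤ m + n, (((π k).1 : ℝ), ((π k).2 : ℝ)) ∉ A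

/-- The first coordinate `⌊N (1 - ρ)²⌋` of the endpoint in the characteristic direction. -/
def endX (ρ N : ℝ) : ℕ := ⌊N * (1 - ρ) ^ 2⌋₊

/-- The second coordinate `⌊N ρ²⌋` of the endpoint in the characteristic direction. -/
def endY (ρ N : ℝ) : ℕ := ⌊N * ρ ^ 2⌋₊

/-- The event that some geodesic from `0` to the endpoint `(m, n) = (endX ρ N, endY ρ N)` does not
intersect the square of side `s` with lower left corner `(t m, t n)`. The geodesic is almost
surely unique, so up to a null set this is the event that the geodesic misses the square. -/
def someGeodesicMisses {Ω : Type*} (w : ℕ × ℕ → Ω → ℝ) (ρ N t s : ℝ) : Set Ω :=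
  {ω | ∃ π, IsGeodesic (fun x => w x ω) (endX ρ N) (endY ρ N) π ∧
    Misses (endX ρ N) (endY ρ N) π (square s (t * endX ρ N, t * endY ρ N))}

/-- The event that every geodesic from `0` to the endpoint misses the square. Up to a null set it
is the same event as `someGeodesicMisses`; as a set it is the smaller of the two, since geodesics
exist. -/
def everyGeodesicMisses {Ω : Type*} (w : ℕ × ℕ → Ω → ℝ) (ρ N t s : ℝ) : Set Ω :=
  {ω | ∀ π, IsGeodesic (fun x => w x ω) (endX ρ N) (endY ρ N) π →
    Misses (endX ρ N) (endY ρ N) π (square s (t * endX ρ N, t * endY ρ N))}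

end StationaryCGM

end

/-! ### Exponential laws and the local Burke map -/

namespace StationaryCGM

/-! Write G for last-passage times from the origin. Fix a site v and replace the weights by the
increments of G along the two axes through v, keeping the bulk weights (`shiftWeights`). By the
Burke property (`IsExpFamily.shiftWeights`) the new family has the same law as the old one.
Moreover, a geodesic that crosses the horizontal axis through v to the right of v forces the best
path with first step e₁, in the model seen from v, to be at least as good as the best path with
first step e₂ (`IsGeodesic.verPassage_le_horPassage`, with its mirror image). Missing the square
thus becomes a question about the exit direction in a stationary model whose endpoint lies at
distance S from the characteristic direction, at scale X = (1-t)N.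

All probability estimates come from one exact identity: with boundary rates a and b, E exp((a+b-1)
G(m,n)) = (b/(1-a))^n (a/(1-b))^m (`IsExpFamily.lintegral_exp_lastPassage`). Tilting the first n
vertical weights makes the model stationary. By Burke the increments along row n are then
independent exponentials and can be tilted in turn; the two densities multiply to a constant times
exp((a+b-1)G). Chernoff's bound gives the upper tail for a+b > 1 and the lower tail for a+b < 1.

Part (a). If horizontal exit wins, enlarging the horizontal boundary weights keeps it winning, and
shrinking the vertical ones then cannot bring G below the horizontal optimum. So the value with
smaller vertical weights is at least the value with the original ones. When the endpoint lies above
the characteristic direction, a level L makes the lower tail of one and the upper tail of the other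
exponentially small (`IsExpFamily.measure_verPassage_le_horPassage`). Optimizing the perturbation s
~ S/X gives exp(-c S³/X²), and S = rN^(2/3) turns this into exp(-c r³), more than the required cubic
decay.

Part (b). With S = X^(2/3), lower the rate of the first l ~ S horizontal weights from c to c-s with
s ~ X^(-1/3). Since l s² = O(1), the density of this change has bounded second moment, so an event
of probability 1/2 under the new measure has original probability bounded below
(`le_measure_of_withDensity`). Under the new measure horizontal exit is strictly better with
probability at least 1/2: some level separates the vertical optimum from G, and the unmodified part
of the axis is irrelevant because in the c-s stationary model seen from (l,0) vertical exit is the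
likely one. Strict horizontal exit from a corner to the lower right of the square keeps every
geodesic out of it (`misses_of_verPassage_lt`). -/

lemma expMeasure_eq_withDensity (r : ℝ) :
    expMeasure r = volume.withDensity (exponentialPDF r) := rfl

@[fun_prop]
lemma measurable_exponentialPDF (r : ℝ) : Measurable (exponentialPDF r) :=
  (measurable_exponentialPDFReal r).ennreal_ofReal

/-- A positive multiple of an exponential random variable is exponential. -/
lemma map_mul_expMeasure {r q : ℝ} (hr : 0 < r) (hq : 0 < q) :
    (expMeasure r).map (fun x => q * x) = expMeasure (r / q) := by
  have := isProbabilityMeasure_expMeasure hr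
  have := isProbabilityMeasure_expMeasure (div_pos hr hq)
  have hm : Measurable fun x : ℝ => q * x := by fun_prop
  have := Measure.isProbabilityMeasure_map (μ := expMeasure r) hm.aemeasurable
  refine Measure.eq_of_cdf _ _ ?_
  ext x
  rw [cdf_expMeasure_eq (div_pos hr hq), cdf_eq_real, map_measureReal_apply hm measurableSet_Iic]
  have : (fun x => q * x) ⁻¹' Set.Iic x = Set.Iic (x / q) := by
    ext y
    simp [le_div_iff₀ hq, mul_comm]
  rw [this, ← cdf_eq_real, cdf_expMeasure_eq hr]
  congr 1
  · simp [le_div_iff₀ hq]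
  · congr 3; ring

/-- Exponential tilting changes the rate of an exponential law. -/
lemma withDensity_expMeasure {r q : ℝ} (hr : 0 < r) :
    (expMeasure r).withDensity (fun x => ENNReal.ofReal (q / r * Real.exp ((r - q) * x))) =
      expMeasure q := by
  rw [expMeasure_eq_withDensity, expMeasure_eq_withDensity,
    ← withDensity_mul _ (by fun_prop) (by fun_prop)]
  congr 1
  ext x
  rw [Pi.mul_apply, exponentialPDF_eq, exponentialPDF_eq]
  split_ifs with h
  · rw [← ENNReal.ofReal_mul (by positivity)]
    congr 1
    have : Real.exp (-(q * x)) = Real.exp (-(r * x)) * Real.exp ((r - q) * x) := by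
      rw [← Real.exp_add]; congr 1; ring
    rw [this]
    field_simp
  · simp

/-- The local update of the corner growth model: from the increments on the south and west sides
of a unit square and the weight at its north-east corner to the increments on the north and east
sides, and the dual weight. -/
def burkeMap (p : ℝ × ℝ × ℝ) : ℝ × ℝ × ℝ :=
  (p.2.2 + max (p.1 - p.2.1) 0, p.2.2 + max (p.2.1 - p.1) 0, min p.1 p.2.1)

@[fun_prop]
lemma measurable_burkeMap : Measurable burkeMap := by
  unfold burkeMap; fun_prop

lemma measurePreserving_shear (g : ℝ → ℝ) (hg : Measurable g) :
    MeasurePreserving (fun p : ℝ × ℝ × ℝ => (p.1, (p.2.1 + g p.1, p.2.2))) := by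
  refine MeasurePreserving.skew_product (f := id) (g := fun x (q : ℝ × ℝ) => (q.1 + g x, q.2))
    (MeasurePreserving.id _) (by fun_prop) (.of_forall fun x => ?_)
  exact ((measurePreserving_add_right volume (g x)).prod (MeasurePreserving.id volume)).map_eq

lemma measurePreserving_shear_fst (c : ℝ) :
    MeasurePreserving (fun p : ℝ × ℝ × ℝ => (p.1 + c * p.2.1, p.2)) := by
  have h : MeasurePreserving (fun p : (ℝ × ℝ) × ℝ => (p.1, p.2 + c * p.1.1)) := by
    refine MeasurePreserving.skew_product (f := id) (g := fun (x : ℝ × ℝ) (q : ℝ) => q + c * x.1)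
      (MeasurePreserving.id _) (by fun_prop) (.of_forall fun x => ?_)
    exact (measurePreserving_add_right volume (c * x.1)).map_eq
  exact (Measure.measurePreserving_swap.comp h).comp Measure.measurePreserving_swap

/-- The map factors into shears and a coordinate swap: pass to the difference x - y, add its
negative part to y to get the minimum, exchange that with z, and undo the shears. -/
lemma measurePreserving_burkeMap_volume : MeasurePreserving burkeMap := by
  have h1 := measurePreserving_shear_fst (-1)
  have h2 := measurePreserving_shear (fun d => min d 0) (by fun_prop)
  have h3 : MeasurePreserving (Prod.map id Prod.swap : ℝ × ℝ × ℝ → ℝ × ℝ × ℝ) :=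
    (MeasurePreserving.id volume).prod Measure.measurePreserving_swap
  have h4 := measurePreserving_shear (fun d => - min d 0) (by fun_prop)
  have h5 := measurePreserving_shear_fst 1
  convert (h5.comp h4).comp (h3.comp (h2.comp h1)) using 1
  ext1 ⟨x, y, z⟩
  simp only [burkeMap, Function.comp_apply, Prod.map, Prod.swap, id, Prod.mk.injEq]
  rcases le_total x y with h | h
  · have h' : x - y ≤ 0 := by linarith
    have h'' : 0 ≤ y - x := by linarith
    have h3 : x + -1 * y ≤ 0 := by linarith
    simp only [h, h', h'', h3, max_eq_left, max_eq_right, min_eq_left]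
    refine ⟨by ring, by ring, by ring⟩
  · have h' : y - x ≤ 0 := by linarith
    have h'' : 0 ≤ x - y := by linarith
    have h3 : 0 ≤ x + -1 * y := by linarith
    simp only [h, h', h'', h3, max_eq_left, max_eq_right, min_eq_right]
    refine ⟨by ring, by ring, by ring⟩

/-- The local Burke property. -/
lemma measurePreserving_burkeMap {a b : ℝ} (ha : 0 < a) (hb : 0 < b) (hab : a + b = 1) :
    MeasurePreserving burkeMap ((expMeasure a).prod ((expMeasure b).prod (expMeasure 1)))
      ((expMeasure a).prod ((expMeasure b).prod (expMeasure 1))) := by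
  have := isProbabilityMeasure_expMeasure ha
  have := isProbabilityMeasure_expMeasure hb
  have := isProbabilityMeasure_expMeasure one_pos
  set d : ℝ × ℝ × ℝ → ENNReal :=
    fun p => exponentialPDF a p.1 * (exponentialPDF b p.2.1 * exponentialPDF 1 p.2.2) with hd
  have hdm : Measurable d := by fun_prop
  have hμ : (expMeasure a).prod ((expMeasure b).prod (expMeasure 1)) = volume.withDensity d := by
    have := isProbabilityMeasure_expMeasure ha
    simp only [expMeasure_eq_withDensity] at *
    rw [prod_withDensity (by fun_prop) (by fun_prop), prod_withDensity (by fun_prop) (by fun_prop)]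
    rfl
  -- On its support the density depends only on x - y and y + z. The map preserves both and
  -- exchanges min x y with z, hence also preserves the support.
  have hinv : ∀ p, d (burkeMap p) = d p := by
    obtain rfl : b = 1 - a := by linarith
    have key : ∀ x y z : ℝ, d (x, y, z) = ENNReal.ofReal
        (if 0 ≤ min x y ∧ 0 ≤ z then a * (1 - a) * Real.exp (-(a * (x - y) + (y + z))) else 0) := by
      intro x y z
      simp only [hd, exponentialPDF_eq, le_min_iff]
      by_cases hx : 0 ≤ x <;> by_cases hy : 0 ≤ y <;> by_cases hz : 0 ≤ z <;>
        simp [hx, hy, hz, -neg_add_rev]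
      rw [← ENNReal.ofReal_mul (by positivity), ← ENNReal.ofReal_mul (by positivity)]
      congr 1
      have : -(a * (x - y) + (y + z)) = -(a * x) + (-((1 - a) * y) + -z) := by ring
      rw [this, Real.exp_add, Real.exp_add]
      ring
    rintro ⟨x, y, z⟩
    rw [burkeMap, key, key]
    have h1 : min (z + max (x - y) 0) (z + max (y - x) 0) = z := by
      rw [min_add_add_left]
      rcases le_total x y with h | h <;> simp [h]
    have h2 : z + max (x - y) 0 - (z + max (y - x) 0) = x - y := by
      rcases le_total x y with h | h <;> simp [h]
    have h3 : z + max (y - x) 0 + min x y = y + z := by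
      rcases le_total x y with h | h <;> simp [h] <;> ring
    simp only [h1, h2, h3, and_comm]
  rw [hμ]
  refine ⟨measurable_burkeMap, ?_⟩
  refine Measure.ext_of_lintegral _ fun f hf => ?_
  rw [lintegral_map hf measurable_burkeMap, lintegral_withDensity_eq_lintegral_mul _ hdm
    (by fun_prop), lintegral_withDensity_eq_lintegral_mul _ hdm hf,
    ← measurePreserving_burkeMap_volume.lintegral_comp (hdm.mul hf)]
  simp [hinv]

/-! ### Independent families with prescribed marginals -/

section

/-- The real random variables `f i` are independent with laws `ν i`. -/
structure HasIndepLaws {ι Ω : Type*} [MeasurableSpace Ω] (P : Measure Ω) (ν : ι → Measure ℝ)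
    (f : ι → Ω → ℝ) : Prop where
  measurable : ∀ i, Measurable (f i)
  law : ∀ i, P.map (f i) = ν i
  indep : iIndepFun f P

namespace HasIndepLaws

variable {ι κ Ω : Type*} [MeasurableSpace Ω] {P : Measure Ω} {ν : ι → Measure ℝ} {f : ι → Ω → ℝ}

lemma measure_preimage (h : HasIndepLaws P ν f) (i : ι) {A : Set ℝ} (hA : MeasurableSet A) :
    P (f i ⁻¹' A) = ν i A := by
  rw [← h.law i, Measure.map_apply (h.measurable i) hA]

lemma measure_box (h : HasIndepLaws P ν f) (T : Finset ι) {A : ι → Set ℝ}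
    (hA : ∀ i, MeasurableSet (A i)) : P (⋂ i ∈ T, f i ⁻¹' A i) = ∏ i ∈ T, ν i (A i) := by
  rw [h.indep.measure_inter_preimage_eq_mul _ fun i _ => hA i]
  exact Finset.prod_congr rfl fun i _ => h.measure_preimage i (hA i)

/-- Independence and the marginal laws follow from the product formula for boxes over index sets
that contain a given finite set. -/
lemma of_box [∀ i, IsProbabilityMeasure (ν i)] (hm : ∀ i, Measurable (f i)) (T₀ : Finset ι)
    (h : ∀ T : Finset ι, T₀ ⊆ T → ∀ A : ι → Set ℝ, (∀ i, MeasurableSet (A i)) →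
      P (⋂ i ∈ T, f i ⁻¹' A i) = ∏ i ∈ T, ν i (A i)) : HasIndepLaws P ν f := by
  classical
  have h' : ∀ T : Finset ι, ∀ A : ι → Set ℝ, (∀ i ∈ T, MeasurableSet (A i)) →
      P (⋂ i ∈ T, f i ⁻¹' A i) = ∏ i ∈ T, ν i (A i) := by
    intro T A hA
    have := h (T₀ ∪ T) Finset.subset_union_left (fun i => if i ∈ T then A i else Set.univ)
      (fun i => by split_ifs with hi; exacts [hA i hi, .univ])
    rw [← Finset.prod_subset (Finset.subset_union_right (s₁ := T₀))] at this
    · rw [Finset.prod_congr rfl (fun i hi => by rw [if_pos hi])] at this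
      rw [← this]
      congr 1
      ext ω
      simp only [Set.mem_iInter, Set.mem_preimage, Finset.mem_union]
      constructor
      · intro hω i _
        split_ifs with hi
        exacts [hω i hi, trivial]
      · intro hω i hi
        simpa [hi] using hω i (Or.inr hi)
    · intro i _ hi
      simp [hi]
  have hlaw : ∀ i, ∀ A : Set ℝ, MeasurableSet A → P (f i ⁻¹' A) = ν i A := by
    intro i A hA
    simpa using h' {i} (fun _ => A) (fun _ _ => hA)
  refine ⟨hm, fun i => ?_, ?_⟩
  · ext A hA
    rw [Measure.map_apply (hm i) hA, hlaw i A hA]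
  · rw [iIndepFun_iff_measure_inter_preimage_eq_mul]
    intro T A hA
    rw [h' T A hA]
    exact Finset.prod_congr rfl fun i hi => (hlaw i _ (hA i hi)).symm

lemma precomp (h : HasIndepLaws P ν f) {g : κ → ι} (hg : g.Injective) :
    HasIndepLaws P (fun k => ν (g k)) (fun k => f (g k)) :=
  ⟨fun _ => h.measurable _, fun _ => h.law _, h.indep.precomp hg⟩

lemma comp (h : HasIndepLaws P ν f) {φ : ι → ℝ → ℝ} (hφ : ∀ i, Measurable (φ i)) :
    HasIndepLaws P (fun i => (ν i).map (φ i)) (fun i ω => φ i (f i ω)) :=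
  ⟨fun i => (hφ i).comp (h.measurable i),
    fun i => by rw [← h.law i, Measure.map_map (hφ i) (h.measurable i)]; rfl,
    h.indep.comp _ hφ⟩

/-- It suffices to check independence on finite sets of indices. -/
lemma of_finset (hm : ∀ i, Measurable (f i))
    (h : ∀ T : Finset ι, HasIndepLaws P (fun i : T => ν i) (fun i : T => f i)) :
    HasIndepLaws P ν f :=
  ⟨hm, fun i => (h {i}).law ⟨i, Finset.mem_singleton_self i⟩,
    iIndepFun_iff_finset.2 fun T => (h T).indep⟩

/-- Change of measure in finitely many of the variables. -/
lemma withDensity [DecidableEq ι] (h : HasIndepLaws P ν f) [∀ i, IsProbabilityMeasure (ν i)]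
    (S : Finset ι) {g : ι → ℝ → ENNReal} (hg : ∀ i, Measurable (g i))
    [∀ i, IsProbabilityMeasure (if i ∈ S then (ν i).withDensity (g i) else ν i)] :
    HasIndepLaws (P.withDensity fun ω => ∏ i ∈ S, g i (f i ω))
      (fun i => if i ∈ S then (ν i).withDensity (g i) else ν i) f := by
  have hm := h.measurable
  refine of_box h.measurable S fun T hT A hA => ?_
  have hbox : MeasurableSet (⋂ i ∈ T, f i ⁻¹' A i) :=
    Finset.measurableSet_biInter _ fun i _ => h.measurable i (hA i)
  -- Over a box the integrand becomes a product of functions of single variables, so its integral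
  -- factors.
  set k : ι → ℝ → ENNReal := fun i x => (if i ∈ S then g i x else 1) * (A i).indicator 1 x with hk
  have hkm : ∀ i, Measurable (k i) := by
    intro i
    refine Measurable.mul ?_ (measurable_one.indicator (hA i))
    split_ifs
    exacts [hg i, measurable_const]
  have hprod : ∀ ω, (⋂ i ∈ T, f i ⁻¹' A i).indicator (fun ω => ∏ i ∈ S, g i (f i ω)) ω =
      ∏ i ∈ T, k i (f i ω) := by
    intro ω
    rw [Finset.prod_mul_distrib, Finset.prod_ite, Finset.prod_const_one, mul_one,
      Finset.filter_mem_eq_inter, Finset.inter_eq_right.2 hT]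
    by_cases hω : ω ∈ ⋂ i ∈ T, f i ⁻¹' A i
    · rw [Set.indicator_of_mem hω]
      rw [Finset.prod_eq_one (s := T), mul_one]
      intro i hi
      simp only [Set.mem_iInter] at hω
      exact Set.indicator_of_mem (s := A i) (f := (1 : ℝ → ENNReal)) (hω i hi)
    · rw [Set.indicator_of_notMem hω]
      simp only [Set.mem_iInter, not_forall] at hω
      obtain ⟨i, hi, hiA⟩ := hω
      rw [Finset.prod_eq_zero (s := T) hi, mul_zero]
      exact Set.indicator_of_notMem (s := A i) hiA _
  rw [withDensity_apply _ hbox, ← lintegral_indicator hbox]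
  simp_rw [hprod]
  rw [lintegral_prod_eq_prod_lintegral_of_indepFun T (fun i ω => k i (f i ω))
    (h.indep.comp _ hkm) fun i => (hkm i).comp (h.measurable i)]
  refine Finset.prod_congr rfl fun i _ => ?_
  rw [← lintegral_map (hkm i) (h.measurable i), h.law i]
  have : ∀ x, k i x = (A i).indicator (fun x => if i ∈ S then g i x else 1) x := by
    intro x
    by_cases hx : x ∈ A i <;> simp [hk, hx]
  simp_rw [this]
  rw [lintegral_indicator (hA i)]
  split_ifs
  · rw [withDensity_apply _ (hA i)]
  · simp

open Classical in
/-- The update of three of the variables by the local Burke map. -/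
lemma burke [∀ i, IsProbabilityMeasure (ν i)] (h : HasIndepLaws P ν f) {p q s : ι}
    (hpq : p ≠ q) (hps : p ≠ s) (hqs : q ≠ s)
    (hν : MeasurePreserving burkeMap ((ν p).prod ((ν q).prod (ν s)))
      ((ν p).prod ((ν q).prod (ν s)))) :
    HasIndepLaws P ν (fun i ω => if i = p then (burkeMap (f p ω, f q ω, f s ω)).1
      else if i = q then (burkeMap (f p ω, f q ω, f s ω)).2.1
      else if i = s then (burkeMap (f p ω, f q ω, f s ω)).2.2 else f i ω) := by
  have hm := h.measurable
  have hP : IsProbabilityMeasure P := h.indep.isProbabilityMeasure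
  have htm : Measurable fun ω => (f p ω, f q ω, f s ω) := by fun_prop
  have hbm : Measurable fun ω => burkeMap (f p ω, f q ω, f s ω) := by fun_prop
  refine of_box (fun i => ?_) {p, q, s} fun T hT A hA => ?_
  · split_ifs
    exacts [hbm.fst, hbm.snd.fst, hbm.snd.snd, hm i]
  have htriple : P.map (fun ω => (f p ω, f q ω, f s ω)) = (ν p).prod ((ν q).prod (ν s)) := by
    have h1 : IndepFun (f p) (fun ω => (f q ω, f s ω)) P :=
      (h.indep.indepFun_prodMk hm q s p hpq.symm hps.symm).symm
    have h2 : IndepFun (f q) (f s) P := h.indep.indepFun hqs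
    rw [(indepFun_iff_map_prod_eq_prod_map_map (hm p).aemeasurable (by fun_prop)).1 h1,
      (indepFun_iff_map_prod_eq_prod_map_map (hm q).aemeasurable (by fun_prop)).1 h2,
      h.law, h.law, h.law]
  set T' := T \ {p, q, s} with hT'
  have hTT : T = {p, q, s} ∪ T' := by rw [hT', Finset.union_sdiff_of_subset hT]
  have hdisj : Disjoint ({p, q, s} : Finset ι) T' := Finset.disjoint_sdiff
  set B : Set Ω := ⋂ i ∈ T', f i ⁻¹' A i with hB
  have hBm : MeasurableSet B := Finset.measurableSet_biInter _ fun i _ => hm i (hA i)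
  set D : Set (ℝ × ℝ × ℝ) := A p ×ˢ (A q ×ˢ A s) with hD
  have hDm : MeasurableSet D := (hA p).prod ((hA q).prod (hA s))
  have hset : (⋂ i ∈ T, (fun ω => if i = p then (burkeMap (f p ω, f q ω, f s ω)).1
      else if i = q then (burkeMap (f p ω, f q ω, f s ω)).2.1
      else if i = s then (burkeMap (f p ω, f q ω, f s ω)).2.2 else f i ω) ⁻¹' A i) =
      (fun ω => (f p ω, f q ω, f s ω)) ⁻¹' (burkeMap ⁻¹' D) ∩ B := by
    ext ω
    have hT'm : ∀ i, i ∈ T' ↔ i ∈ T ∧ i ≠ p ∧ i ≠ q ∧ i ≠ s := by intro i; simp [hT']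
    simp only [Set.mem_iInter, Set.mem_preimage, Set.mem_inter_iff, hD, Set.mem_prod, hB]
    constructor
    · intro hω
      refine ⟨⟨?_, ?_, ?_⟩, ?_⟩
      · simpa using hω p (hT (by simp))
      · simpa [hpq.symm] using hω q (hT (by simp))
      · simpa [hps.symm, hqs.symm] using hω s (hT (by simp))
      · intro i hi
        obtain ⟨hiT, h1, h2, h3⟩ := (hT'm i).1 hi
        simpa [h1, h2, h3] using hω i hiT
    · rintro ⟨⟨h1, h2, h3⟩, h4⟩ i hi
      split_ifs with hip hiq his
      · subst hip; exact h1
      · subst hiq; exact h2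
      · subst his; exact h3
      · exact h4 i ((hT'm i).2 ⟨hi, hip, hiq, his⟩)
  have hind : IndepFun (fun ω => (f p ω, f q ω, f s ω)) (fun ω (i : T') => f i ω) P := by
    refine (h.indep.indepFun_finset {p, q, s} T' hdisj hm).comp
      (φ := fun z => (z ⟨p, by simp⟩, z ⟨q, by simp⟩, z ⟨s, by simp⟩)) (ψ := id) ?_ measurable_id
    fun_prop
  have hB' : B = (fun ω (i : T') => f i ω) ⁻¹' (⋂ i : T', (fun z => z i) ⁻¹' A i) := by
    ext ω
    simp [hB]
  have hBm' : MeasurableSet (⋂ i : T', (fun z : T' → ℝ => z i) ⁻¹' A i) :=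
    MeasurableSet.iInter fun i => (measurable_pi_apply i) (hA i)
  rw [hset, hB', hind.measure_inter_preimage_eq_mul _ _ (measurable_burkeMap hDm) hBm', ← hB', hB,
    h.measure_box T' hA, ← Measure.map_apply htm (measurable_burkeMap hDm), htriple,
    hν.measure_preimage hDm.nullMeasurableSet, hD, Measure.prod_prod, Measure.prod_prod, hTT,
    Finset.prod_union hdisj, Finset.prod_insert (by simp [hpq, hps]),
    Finset.prod_insert (by simp [hqs]), Finset.prod_singleton]

end HasIndepLaws

end

/-! ### Last-passage recursions, first-step decomposition and change of origin -/

/-- Last-passage times on the quadrant, the weight of the corner included. -/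
def lpp (w : ℕ × ℕ → ℝ) : ℕ → ℕ → ℝ
  | 0, 0 => w (0, 0)
  | m + 1, 0 => lpp w m 0 + w (m + 1, 0)
  | 0, n + 1 => lpp w 0 n + w (0, n + 1)
  | m + 1, n + 1 => max (lpp w m (n + 1)) (lpp w (m + 1) n) + w (m + 1, n + 1)

/-- Last-passage times from the corner, whose weight is not used. -/
def lastPassage (w : ℕ × ℕ → ℝ) : ℕ → ℕ → ℝ := lpp fun x => if x = 0 then 0 else w x

/-- `horPassage w m n` is the last-passage time to `(m + 1, n)` over paths whose first step is
horizontal. -/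
def horPassage (w : ℕ × ℕ → ℝ) : ℕ → ℕ → ℝ := lpp fun x => w (x.1 + 1, x.2)

/-- `verPassage w m n` is the last-passage time to `(m, n + 1)` over paths whose first step is
vertical. -/
def verPassage (w : ℕ × ℕ → ℝ) : ℕ → ℕ → ℝ := lpp fun x => w (x.1, x.2 + 1)

/-- The weights of the corner growth model seen from `v`: increments of the last-passage times
on the axes through `v` and the original weights in the bulk. -/
def shiftWeights (v : ℕ × ℕ) (w : ℕ × ℕ → ℝ) : ℕ × ℕ → ℝ := fun x =>
  if x = 0 then 0
  else if x.2 = 0 then lastPassage w (v.1 + x.1) v.2 - lastPassage w (v.1 + x.1 - 1) v.2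
  else if x.1 = 0 then lastPassage w v.1 (v.2 + x.2) - lastPassage w v.1 (v.2 + x.2 - 1)
  else w (v.1 + x.1, v.2 + x.2)

lemma lpp_mono {w w' : ℕ × ℕ → ℝ} (h : ∀ x, w x ≤ w' x) : ∀ m n, lpp w m n ≤ lpp w' m n
  | 0, 0 => by simpa [lpp] using h _
  | m + 1, 0 => by simpa [lpp] using add_le_add (lpp_mono h m 0) (h _)
  | 0, n + 1 => by simpa [lpp] using add_le_add (lpp_mono h 0 n) (h _)
  | m + 1, n + 1 => by
    simpa only [lpp] using
      add_le_add (max_le_max (lpp_mono h m (n + 1)) (lpp_mono h (m + 1) n)) (h _)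

lemma lpp_swap (w : ℕ × ℕ → ℝ) : ∀ m n, lpp (fun x => w x.swap) m n = lpp w n m
  | 0, 0 => by simp [lpp]
  | m + 1, 0 => by simp [lpp, lpp_swap w m 0]
  | 0, n + 1 => by simp [lpp, lpp_swap w 0 n]
  | m + 1, n + 1 => by
    simp only [lpp]
    rw [lpp_swap w m (n + 1), lpp_swap w (m + 1) n, max_comm, Prod.swap_prod_mk]

lemma lpp_add_le_right (w : ℕ × ℕ → ℝ) (m n : ℕ) :
    lpp w m n + w (m + 1, n) ≤ lpp w (m + 1) n := by
  cases n with
  | zero => simp [lpp]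
  | succ n => simp [lpp]

lemma lpp_add_le_up (w : ℕ × ℕ → ℝ) (m n : ℕ) :
    lpp w m n + w (m, n + 1) ≤ lpp w m (n + 1) := by
  cases m with
  | zero => simp [lpp]
  | succ m => simp [lpp]

lemma lpp_congr {w w' : ℕ × ℕ → ℝ} : ∀ m n, (∀ x, x.1 ≤ m → x.2 ≤ n → w x = w' x) →
    lpp w m n = lpp w' m n
  | 0, 0, h => by simpa [lpp] using h (0, 0) le_rfl le_rfl
  | m + 1, 0, h => by
    simp only [lpp]
    rw [lpp_congr m 0 fun x h1 h2 => h x (by omega) h2, h (m + 1, 0) le_rfl le_rfl]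
  | 0, n + 1, h => by
    simp only [lpp]
    rw [lpp_congr 0 n fun x h1 h2 => h x h1 (by omega), h (0, n + 1) le_rfl le_rfl]
  | m + 1, n + 1, h => by
    simp only [lpp]
    rw [lpp_congr m (n + 1) fun x h1 h2 => h x (by omega) h2,
      lpp_congr (m + 1) n fun x h1 h2 => h x h1 (by omega), h (m + 1, n + 1) le_rfl le_rfl]

lemma measurable_lpp {Ω : Type*} [MeasurableSpace Ω] {w : ℕ × ℕ → Ω → ℝ}
    (h : ∀ x, Measurable (w x)) : ∀ m n, Measurable fun ω => lpp (fun x => w x ω) m n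
  | 0, 0 => by simpa only [lpp] using h _
  | m + 1, 0 => by
    have := measurable_lpp h m 0
    simp only [lpp]; fun_prop
  | 0, n + 1 => by
    have := measurable_lpp h 0 n
    simp only [lpp]; fun_prop
  | m + 1, n + 1 => by
    have := measurable_lpp h m (n + 1)
    have := measurable_lpp h (m + 1) n
    simp only [lpp]; fun_prop

section

variable (w : ℕ × ℕ → ℝ)

@[simp] lemma lastPassage_zero : lastPassage w 0 0 = 0 := by simp [lastPassage, lpp]

lemma lastPassage_succ_zero (m : ℕ) :
    lastPassage w (m + 1) 0 = lastPassage w m 0 + w (m + 1, 0) := by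
  simp [lastPassage, lpp]

lemma lastPassage_zero_succ (n : ℕ) :
    lastPassage w 0 (n + 1) = lastPassage w 0 n + w (0, n + 1) := by
  simp [lastPassage, lpp]

lemma lastPassage_succ_succ (m n : ℕ) : lastPassage w (m + 1) (n + 1) =
    max (lastPassage w m (n + 1)) (lastPassage w (m + 1) n) + w (m + 1, n + 1) := by
  simp [lastPassage, lpp]

lemma lastPassage_add_le_right (m n : ℕ) :
    lastPassage w m n + w (m + 1, n) ≤ lastPassage w (m + 1) n := by
  simpa [lastPassage] using lpp_add_le_right (fun x => if x = 0 then 0 else w x) m n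

lemma lastPassage_add_le_up (m n : ℕ) :
    lastPassage w m n + w (m, n + 1) ≤ lastPassage w m (n + 1) := by
  simpa [lastPassage] using lpp_add_le_up (fun x => if x = 0 then 0 else w x) m n

lemma lastPassage_swap (m n : ℕ) :
    lastPassage (fun x => w x.swap) m n = lastPassage w n m := by
  rw [lastPassage, lastPassage, ← lpp_swap]
  congr 1
  ext ⟨a, b⟩
  simp [and_comm]

lemma horPassage_swap (m n : ℕ) :
    horPassage (fun x => w x.swap) m n = verPassage w n m := by
  rw [horPassage, verPassage, ← lpp_swap]
  rfl

lemma verPassage_swap (m n : ℕ) :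
    verPassage (fun x => w x.swap) m n = horPassage w n m := by
  rw [horPassage, verPassage, ← lpp_swap]
  rfl

lemma shiftWeights_swap (v : ℕ × ℕ) :
    shiftWeights v.swap (fun x => w x.swap) = fun x => shiftWeights v w x.swap := by
  ext ⟨a, b⟩
  simp only [shiftWeights, lastPassage_swap, Prod.fst_swap, Prod.snd_swap]
  rcases eq_or_ne a 0 with rfl | ha <;> rcases eq_or_ne b 0 with rfl | hb <;> simp [*]

lemma lastPassage_succ_zero_eq_horPassage (m : ℕ) :
    lastPassage w (m + 1) 0 = horPassage w m 0 := by
  induction m with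
  | zero => simp [lastPassage_succ_zero, horPassage, lpp]
  | succ m ih => rw [lastPassage_succ_zero, ih]; simp [horPassage, lpp]

lemma lastPassage_zero_succ_eq_verPassage (n : ℕ) :
    lastPassage w 0 (n + 1) = verPassage w 0 n := by
  induction n with
  | zero => simp [lastPassage_zero_succ, verPassage, lpp]
  | succ m ih => rw [lastPassage_zero_succ, ih]; simp [verPassage, lpp]

/-- Decomposition of the last-passage time according to the first step of the path. -/
lemma lastPassage_eq_max : ∀ m n, lastPassage w (m + 1) (n + 1) =
    max (horPassage w m (n + 1)) (verPassage w (m + 1) n)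
  | 0, 0 => by
    simp only [lastPassage_succ_succ, lastPassage_succ_zero_eq_horPassage,
      lastPassage_zero_succ_eq_verPassage]
    simp only [horPassage, verPassage, lpp]
    rw [max_comm, max_add_add_right]
  | m + 1, 0 => by
    rw [lastPassage_succ_succ, lastPassage_eq_max m 0, lastPassage_succ_zero_eq_horPassage]
    simp only [horPassage, verPassage, lpp]
    rw [max_right_comm, max_add_add_right]
  | 0, n + 1 => by
    rw [lastPassage_succ_succ, lastPassage_eq_max 0 n, lastPassage_zero_succ_eq_verPassage]
    simp only [horPassage, verPassage, lpp]
    rw [max_left_comm, max_add_add_right]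
  | m + 1, n + 1 => by
    rw [lastPassage_succ_succ, lastPassage_eq_max m (n + 1), lastPassage_eq_max (m + 1) n]
    simp only [horPassage, verPassage, lpp]
    rw [max_max_max_comm, max_add_add_right]

/-- Last-passage times from `v` with the increments as boundary weights. -/
lemma lastPassage_shiftWeights (v : ℕ × ℕ) : ∀ m n, lastPassage (shiftWeights v w) m n =
    lastPassage w (v.1 + m) (v.2 + n) - lastPassage w v.1 v.2
  | 0, 0 => by simp
  | m + 1, 0 => by
    rw [lastPassage_succ_zero, lastPassage_shiftWeights v m 0]
    simp [shiftWeights, ← add_assoc]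
  | 0, n + 1 => by
    rw [lastPassage_zero_succ, lastPassage_shiftWeights v 0 n]
    simp [shiftWeights, ← add_assoc]
  | m + 1, n + 1 => by
    rw [lastPassage_succ_succ, lastPassage_shiftWeights v m (n + 1),
      lastPassage_shiftWeights v (m + 1) n, max_sub_sub_right]
    simp only [← add_assoc, lastPassage_succ_succ]
    simp [shiftWeights, ← add_assoc]
    ring

/-- An increment of G along the axis is at least the weight just collected. Hence a path that has
passed v loses nothing when it is weighed in the model seen from v. -/
lemma le_shiftWeights (v : ℕ × ℕ) (m n : ℕ) :
    w (v.1 + (m + 1), v.2 + n) ≤ shiftWeights v w (m + 1, n) := by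
  cases n with
  | zero =>
    have := lastPassage_add_le_right w (v.1 + m) v.2
    simp [shiftWeights, ← add_assoc]
    linarith
  | succ n => simp [shiftWeights]

end

/-! ### Geodesics and exit directions -/

lemma passageTime_le_lastPassage (w : ℕ × ℕ → ℝ) {m n : ℕ} {π : ℕ → ℕ × ℕ}
    (h : IsUpRightPath m n π) : ∀ k ≤ m + n,
      ∑ i ∈ Finset.Icc 1 k, w (π i) ≤ lastPassage w (π k).1 (π k).2 := by
  intro k
  induction k with
  | zero => simp [h.1]
  | succ k ih =>
    intro hk
    rw [Finset.sum_Icc_succ_top (by omega)]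
    have ih := ih (by omega)
    rcases h.2.2 k (by omega) with h' | h' <;> rw [h']
    · exact le_trans (add_le_add ih le_rfl) (lastPassage_add_le_right w (π k).1 (π k).2)
    · exact le_trans (add_le_add ih le_rfl) (lastPassage_add_le_up w (π k).1 (π k).2)

lemma IsUpRightPath.extend (w : ℕ × ℕ → ℝ) {m n m' n' : ℕ} {π : ℕ → ℕ × ℕ}
    (h : IsUpRightPath m n π)
    (h' : (m', n') = (m, n) + (1, 0) ∨ (m', n') = (m, n) + (0, 1)) :
    ∃ π', IsUpRightPath m' n' π' ∧ passageTime w m' n' π' = passageTime w m n π + w (m', n') := by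
  have hs : m' + n' = m + n + 1 := by
    rcases h' with h' | h' <;> simp at h' <;> omega
  refine ⟨fun k => if k ≤ m + n then π k else (m', n'), ⟨by simp [h.1], by simp [hs], ?_⟩, ?_⟩
  · intro k hk
    rcases Nat.lt_or_ge k (m + n) with hk' | hk'
    · simpa [hk'.le, Nat.succ_le_of_lt hk'] using h.2.2 k hk'
    · obtain rfl : k = m + n := by omega
      simpa [h.2.1] using h'
  · rw [passageTime, passageTime, hs, Finset.sum_Icc_succ_top (by omega)]
    congr 1
    · refine Finset.sum_congr rfl fun k hk => ?_
      simp [(Finset.mem_Icc.1 hk).2]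
    · simp

lemma exists_passageTime_eq (w : ℕ × ℕ → ℝ) : ∀ m n,
    ∃ π, IsUpRightPath m n π ∧ passageTime w m n π = lastPassage w m n
  | 0, 0 => ⟨fun _ => 0, ⟨rfl, rfl, by simp⟩, by simp [passageTime]⟩
  | m + 1, 0 => by
    obtain ⟨π, h, h'⟩ := exists_passageTime_eq w m 0
    rw [lastPassage_succ_zero, ← h']
    exact h.extend w (Or.inl rfl)
  | 0, n + 1 => by
    obtain ⟨π, h, h'⟩ := exists_passageTime_eq w 0 n
    rw [lastPassage_zero_succ, ← h']
    exact h.extend w (Or.inr rfl)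
  | m + 1, n + 1 => by
    rw [lastPassage_succ_succ]
    rcases max_choice (lastPassage w m (n + 1)) (lastPassage w (m + 1) n) with hc | hc <;> rw [hc]
    · obtain ⟨π, h, h'⟩ := exists_passageTime_eq w m (n + 1)
      rw [← h']
      exact h.extend w (Or.inl rfl)
    · obtain ⟨π, h, h'⟩ := exists_passageTime_eq w (m + 1) n
      rw [← h']
      exact h.extend w (Or.inr rfl)

lemma IsGeodesic.lastPassage_le {w : ℕ × ℕ → ℝ} {m n : ℕ} {π : ℕ → ℕ × ℕ}
    (h : IsGeodesic w m n π) : lastPassage w m n ≤ passageTime w m n π := by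
  obtain ⟨π', h1, h2⟩ := exists_passageTime_eq w m n
  exact h2 ▸ h.2 π' h1

lemma IsUpRightPath.swap {m n : ℕ} {π : ℕ → ℕ × ℕ} (h : IsUpRightPath m n π) :
    IsUpRightPath n m fun k => (π k).swap := by
  refine ⟨by simp [h.1], by simp [add_comm n m, h.2.1], fun k hk => ?_⟩
  rcases h.2.2 k (by omega) with h' | h'
  · right; simp [h']
  · left; simp [h']

lemma IsGeodesic.swap {w : ℕ × ℕ → ℝ} {m n : ℕ} {π : ℕ → ℕ × ℕ} (h : IsGeodesic w m n π) :
    IsGeodesic (fun x => w x.swap) n m fun k => (π k).swap := by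
  refine ⟨h.1.swap, fun π' hπ' => ?_⟩
  have := h.2 _ hπ'.swap
  simpa [passageTime, add_comm n m] using this

/-- If a geodesic crosses the horizontal axis through `v` to the right of `v`, then
the horizontal exit from `v` is optimal. -/
lemma IsGeodesic.verPassage_le_horPassage {w : ℕ × ℕ → ℝ} {v : ℕ × ℕ} {m n : ℕ}
    {π : ℕ → ℕ × ℕ} (h : IsGeodesic w (v.1 + (m + 1)) (v.2 + (n + 1)) π) {k₀ i : ℕ}
    (hk₀ : k₀ ≤ v.1 + (m + 1) + (v.2 + (n + 1))) (hi : π k₀ = (v.1 + (i + 1), v.2)) :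
    verPassage (shiftWeights v w) (m + 1) n ≤ horPassage (shiftWeights v w) m (n + 1) := by
  set u := shiftWeights v w with hu
  -- Invariant after the crossing: the weight collected so far is at most G(v) plus the best
  -- horizontal-exit value to the current site. At the endpoint this bounds G by G(v) plus the
  -- horizontal value.
  have key : ∀ k, k₀ ≤ k → k ≤ v.1 + (m + 1) + (v.2 + (n + 1)) → ∃ a b,
      π k = (v.1 + (a + 1), v.2 + b) ∧
        ∑ i ∈ Finset.Icc 1 k, w (π i) ≤ horPassage u a b + lastPassage w v.1 v.2 := by
    intro k hk
    induction k, hk using Nat.le_induction with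
    | base =>
      refine fun _ => ⟨i, 0, hi, ?_⟩
      have h1 := passageTime_le_lastPassage w h.1 k₀ hk₀
      rw [hi] at h1
      have h2 := lastPassage_shiftWeights w v (i + 1) 0
      rw [lastPassage_succ_zero_eq_horPassage] at h2
      simp only [add_zero] at h2
      linarith
    | succ k hk ih =>
      intro hk'
      obtain ⟨a, b, hab, hle⟩ := ih (by omega)
      rw [Finset.sum_Icc_succ_top (by omega)]
      rcases h.1.2.2 k (by omega) with h' | h'
      · refine ⟨a + 1, b, by rw [h', hab]; simp [add_assoc], ?_⟩
        have h1 := lpp_add_le_right (fun x => u (x.1 + 1, x.2)) a b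
        have h2 := le_shiftWeights w v (a + 1) b
        have h3 : π (k + 1) = (v.1 + (a + 1 + 1), v.2 + b) := by rw [h', hab]; simp [add_assoc]
        rw [h3]
        rw [horPassage] at hle ⊢
        linarith
      · refine ⟨a, b + 1, by rw [h', hab]; simp [add_assoc], ?_⟩
        have h1 := lpp_add_le_up (fun x => u (x.1 + 1, x.2)) a b
        have h2 := le_shiftWeights w v a (b + 1)
        have h3 : π (k + 1) = (v.1 + (a + 1), v.2 + (b + 1)) := by
          rw [h', hab]; simp [add_assoc]
        rw [h3]
        rw [horPassage] at hle ⊢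
        linarith
  obtain ⟨a, b, hab, hle⟩ := key _ hk₀ le_rfl
  rw [h.1.2.1] at hab
  simp only [Prod.mk.injEq, Nat.add_left_cancel_iff, add_left_inj] at hab
  obtain ⟨rfl, rfl⟩ := hab
  have h1 := h.lastPassage_le
  have h2 := lastPassage_shiftWeights w v (m + 1) (n + 1)
  have h3 := lastPassage_eq_max u m n
  have h4 := le_max_right (horPassage u m (n + 1)) (verPassage u (m + 1) n)
  rw [passageTime] at h1
  linarith

lemma IsGeodesic.horPassage_le_verPassage {w : ℕ × ℕ → ℝ} {v : ℕ × ℕ} {m n : ℕ}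
    {π : ℕ → ℕ × ℕ} (h : IsGeodesic w (v.1 + (m + 1)) (v.2 + (n + 1)) π) {k₀ i : ℕ}
    (hk₀ : k₀ ≤ v.1 + (m + 1) + (v.2 + (n + 1))) (hi : π k₀ = (v.1, v.2 + (i + 1))) :
    horPassage (shiftWeights v w) m (n + 1) ≤ verPassage (shiftWeights v w) (m + 1) n := by
  have := h.swap.verPassage_le_horPassage (v := v.swap) (k₀ := k₀) (i := i)
    (by simp; omega) (by simp [hi])
  rwa [shiftWeights_swap, horPassage_swap, verPassage_swap] at this

/-- Truncation of the horizontal boundary: if `w` and `w'` agree except on the horizontal axis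
beyond `l`, then paths that leave the axis up to `l` have the same weights. -/
lemma horPassage_le_max {w w' : ℕ × ℕ → ℝ} {l : ℕ}
    (h : ∀ x, x ≠ 0 → (x.2 ≠ 0 ∨ x.1 ≤ l) → w' x = w x) (m n : ℕ) :
    horPassage w (l + m) n ≤ max (horPassage w' (l + m) n)
      (lastPassage w l 0 + horPassage (shiftWeights (l, 0) w) m n) := by
  -- Increments along row 0 are the weights themselves, so horizontal-exit values seen from (l,0)
  -- use only weights of w.
  have hs : (fun x : ℕ × ℕ => shiftWeights (l, 0) w (x.1 + 1, x.2)) =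
      fun x => w (l + (x.1 + 1), x.2) := by
    ext ⟨a, b⟩
    cases b with
    | zero => simp [shiftWeights, ← add_assoc, lastPassage_succ_zero]
    | succ b => simp [shiftWeights]
  have hb : ∀ m, horPassage w (l + m) 0 =
      lastPassage w l 0 + horPassage (shiftWeights (l, 0) w) m 0 := by
    intro m
    rw [← lastPassage_succ_zero_eq_horPassage, ← lastPassage_succ_zero_eq_horPassage,
      lastPassage_shiftWeights]
    simp [add_assoc]
  have hstep : ∀ m n, horPassage w (l + m) n ≤ max (horPassage w' (l + m) n)
        (lastPassage w l 0 + horPassage (shiftWeights (l, 0) w) m n) →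
      horPassage w (l + m) n + w (l + m + 1, n + 1) ≤ max (horPassage w' (l + m) (n + 1))
        (lastPassage w l 0 + horPassage (shiftWeights (l, 0) w) m (n + 1)) := by
    intro m n hmn
    have h1 := lpp_add_le_up (fun x => w' (x.1 + 1, x.2)) (l + m) n
    have h2 := lpp_add_le_up (fun x => w (l + (x.1 + 1), x.2)) m n
    rw [h _ (by simp) (by simp)] at h1
    simp only [horPassage, hs, ← add_assoc] at *
    rcases le_max_iff.1 hmn with h3 | h3
    · exact le_max_of_le_left (by linarith)
    · exact le_max_of_le_right (by linarith)
  induction n generalizing m with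
  | zero => exact (hb m).le.trans (le_max_right _ _)
  | succ n ih =>
    induction m with
    | zero =>
      have h1 := hstep 0 n (ih 0)
      rcases l with _ | l
      · simpa [horPassage, lpp] using h1
      · have h0 : horPassage w l (n + 1) = horPassage w' l (n + 1) :=
          lpp_congr _ _ fun x hx _ => (h _ (by simp) (Or.inr (by simpa using hx))).symm
        have h2 := lpp_add_le_right (fun x => w' (x.1 + 1, x.2)) l (n + 1)
        rw [h _ (by simp) (by simp)] at h2
        have h3 : horPassage w (l + 1 + 0) (n + 1) = max (horPassage w l (n + 1))
          (horPassage w (l + 1) n) + w (l + 1 + 1, n + 1) := by simp [horPassage, lpp]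
        rw [h3, ← max_add_add_right]
        refine max_le (le_max_of_le_left ?_) h1
        rw [h0]
        exact h2
    | succ m ihm =>
      have h1 := hstep (m + 1) n (ih (m + 1))
      have h3 : horPassage w (l + (m + 1)) (n + 1) = max (horPassage w (l + m) (n + 1))
          (horPassage w (l + (m + 1)) n) + w (l + (m + 1) + 1, n + 1) := by
        simp [horPassage, lpp, ← add_assoc]
      rw [h3, ← max_add_add_right]
      refine max_le ?_ h1
      have h4 := lpp_add_le_right (fun x => w' (x.1 + 1, x.2)) (l + m) (n + 1)
      have h5 := lpp_add_le_right (fun x => w (l + (x.1 + 1), x.2)) m (n + 1)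
      rw [h _ (by simp) (by simp)] at h4
      simp only [horPassage, hs, ← add_assoc] at *
      rcases le_max_iff.1 ihm with h6 | h6
      · exact le_max_of_le_left (by linarith)
      · exact le_max_of_le_right (by linarith)

/-! ### Burke property of the quadrant -/

section

/-- Rates of the corner growth model with boundary rates `a` on the horizontal and `b` on the
vertical axis. -/
def boundaryRate (a b : ℝ) (x : ℕ × ℕ) : ℝ := if x.2 = 0 then a else if x.1 = 0 then b else 1

/-- The weights `w x`, `x ≠ 0`, are independent exponentials with rates `r x`. -/
def IsExpFamily {Ω : Type*} [MeasurableSpace Ω] (P : Measure Ω) (r : ℕ × ℕ → ℝ)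
    (w : ℕ × ℕ → Ω → ℝ) : Prop :=
  HasIndepLaws P (fun x : {x : ℕ × ℕ // x ≠ 0} => expMeasure (r x)) (fun x => w x)

variable {Ω : Type*} [MeasurableSpace Ω] {P : Measure Ω} {r : ℕ × ℕ → ℝ} {w : ℕ × ℕ → Ω → ℝ}
  {a b : ℝ}

lemma boundaryRate_pos (ha : 0 < a) (hb : 0 < b) (x : ℕ × ℕ) : 0 < boundaryRate a b x := by
  unfold boundaryRate
  split_ifs <;> positivity

lemma boundaryRate_swap (x : ℕ × ℕ) (hx : x ≠ 0) : boundaryRate a b x.swap = boundaryRate b a x := by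
  obtain ⟨i, j⟩ := x
  rcases eq_or_ne i 0 with rfl | hi <;> rcases eq_or_ne j 0 with rfl | hj <;>
    simp_all [boundaryRate]

lemma IsWeightFamily.isExpFamily {ρ : ℝ} (h : IsWeightFamily P ρ w) :
    IsExpFamily P (boundaryRate (1 - ρ) ρ) w :=
  ⟨fun x => h.measurable x x.2, fun x => h.law x x.2, h.indep⟩

lemma measurable_lastPassage (h : ∀ x, x ≠ 0 → Measurable (w x)) (m n : ℕ) :
    Measurable fun ω => lastPassage (fun x => w x ω) m n := by
  refine measurable_lpp (w := fun x ω => if x = 0 then 0 else w x ω) (fun x => ?_) m n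
  split_ifs with hx
  exacts [measurable_const, h x hx]

lemma measurable_horPassage (h : ∀ x, x ≠ 0 → Measurable (w x)) (m n : ℕ) :
    Measurable fun ω => horPassage (fun x => w x ω) m n :=
  measurable_lpp (w := fun x => w (x.1 + 1, x.2)) (fun _ => h _ (by simp)) m n

lemma measurable_verPassage (h : ∀ x, x ≠ 0 → Measurable (w x)) (m n : ℕ) :
    Measurable fun ω => verPassage (fun x => w x ω) m n :=
  measurable_lpp (w := fun x => w (x.1, x.2 + 1)) (fun _ => h _ (by simp)) m n

lemma measurable_shiftWeights (h : ∀ x, x ≠ 0 → Measurable (w x)) (v x : ℕ × ℕ) :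
    Measurable fun ω => shiftWeights v (fun x => w x ω) x := by
  have := measurable_lastPassage h
  simp only [shiftWeights]
  split_ifs with h1 h2 h3
  · fun_prop
  · fun_prop
  · fun_prop
  · exact h _ (by simp [h3])

namespace IsExpFamily

lemma measurable_of_ne (h : IsExpFamily P r w) (x : ℕ × ℕ) (hx : x ≠ 0) : Measurable (w x) :=
  h.measurable ⟨x, hx⟩

lemma isProbabilityMeasure (h : IsExpFamily P r w) : IsProbabilityMeasure P :=
  h.indep.isProbabilityMeasure

lemma congr {r' : ℕ × ℕ → ℝ} {w' : ℕ × ℕ → Ω → ℝ} (h : IsExpFamily P r w)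
    (hr : ∀ x, x ≠ 0 → r x = r' x) (hw : ∀ x, x ≠ 0 → w x = w' x) : IsExpFamily P r' w' := by
  unfold IsExpFamily at *
  convert h using 2 with x x
  · rw [hr x x.2]
  · rw [hw x x.2]

lemma scale (h : IsExpFamily P r w) (hr : ∀ x, 0 < r x) {q : ℕ × ℕ → ℝ} (hq : ∀ x, 0 < q x) :
    IsExpFamily P (fun x => r x / q x) (fun x ω => q x * w x ω) := by
  have := HasIndepLaws.comp h (φ := fun x y => q x * y) (by fun_prop)
  unfold IsExpFamily
  convert this using 2 with x
  exact (map_mul_expMeasure (hr x) (hq x)).symm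

lemma nonneg (h : IsExpFamily P r w) : ∀ᵐ ω ∂P, ∀ x, x ≠ 0 → 0 ≤ w x ω := by
  rw [ae_all_iff]
  intro x
  by_cases hx : x = 0
  · simp [hx]
  have h1 : ∀ᵐ y ∂(P.map (w x)), 0 ≤ y := by
    have h2 : P.map (w x) = expMeasure (r x) := h.law ⟨x, hx⟩
    rw [h2, ae_iff, expMeasure_eq_withDensity]
    have : {a : ℝ | ¬ 0 ≤ a} = Set.Iio 0 := by ext; simp
    rw [this, withDensity_apply _ measurableSet_Iio, lintegral_exponentialPDF_of_nonpos le_rfl]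
  filter_upwards [ae_of_ae_map (h.measurable_of_ne x hx).aemeasurable h1] with ω hω _ using hω

lemma swap (h : IsExpFamily P r w) : IsExpFamily P (fun x => r x.swap) (fun x => w x.swap) := by
  have := HasIndepLaws.precomp h (g := fun x : {x : ℕ × ℕ // x ≠ 0} =>
    ⟨x.1.swap, fun h => x.2 (by simpa using congrArg Prod.swap h)⟩) (by
      intro x y hxy
      simpa [Subtype.ext_iff, Prod.ext_iff, and_comm] using hxy)
  exact this

open Classical in
/-- Change of the rates of finitely many weights by a change of measure. -/
lemma tilt (h : IsExpFamily P r w) (hr : ∀ x, 0 < r x) (S : Finset {x : ℕ × ℕ // x ≠ 0})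
    {q : ℕ × ℕ → ℝ} (hq : ∀ x, 0 < q x) :
    IsExpFamily (P.withDensity fun ω => ∏ x ∈ S,
        ENNReal.ofReal (q x / r x * Real.exp ((r x - q x) * w x ω)))
      (fun x => if x ∈ S.map (Function.Embedding.subtype _) then q x else r x) w := by
  have (x : {x : ℕ × ℕ // x ≠ 0}) := isProbabilityMeasure_expMeasure (hr x)
  have hlaw : ∀ x : {x : ℕ × ℕ // x ≠ 0},
      (if x ∈ S then (expMeasure (r x)).withDensity
        (fun y => ENNReal.ofReal (q x / r x * Real.exp ((r x - q x) * y))) else expMeasure (r x)) =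
      expMeasure (if (x : ℕ × ℕ) ∈ S.map (Function.Embedding.subtype _) then q x else r x) := by
    intro x
    have : (x : ℕ × ℕ) ∈ S.map (Function.Embedding.subtype _) ↔ x ∈ S := by
      simpa using fun _ => x.2
    simp only [this]
    split_ifs
    · exact withDensity_expMeasure (hr x)
    · rfl
  have hp (x : {x : ℕ × ℕ // x ≠ 0}) : IsProbabilityMeasure
      (if x ∈ S then (expMeasure (r x)).withDensity
        (fun y => ENNReal.ofReal (q x / r x * Real.exp ((r x - q x) * y))) else expMeasure (r x)) := by
    rw [hlaw]
    refine isProbabilityMeasure_expMeasure ?_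
    split_ifs
    exacts [hq x, hr x]
  have := HasIndepLaws.withDensity h S
    (g := fun x y => ENNReal.ofReal (q x / r x * Real.exp ((r x - q x) * y))) (by fun_prop)
  simp only [hlaw] at this
  exact this

end IsExpFamily

/-- The family of weights in the course of the replacement of the increments along column `0`
by those along column `1`: the first `n` squares have been updated. -/
def columnUpdate {Ω : Type*} (w : ℕ × ℕ → Ω → ℝ) : ℕ → ℕ × ℕ → Ω → ℝ
  | 0 => w
  | n + 1 => fun x ω =>
    let p := burkeMap (columnUpdate w n (1, 0) ω, columnUpdate w n (0, n + 1) ω,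
      columnUpdate w n (1, n + 1) ω)
    if x = (1, 0) then p.1 else if x = (0, n + 1) then p.2.1 else if x = (1, n + 1) then p.2.2
    else columnUpdate w n x ω

lemma IsExpFamily.columnUpdate (h : IsExpFamily P (boundaryRate a b) w) (ha : 0 < a) (hb : 0 < b)
    (hab : a + b = 1) (n : ℕ) : IsExpFamily P (boundaryRate a b) (columnUpdate w n) := by
  induction n with
  | zero => exact h
  | succ n ih =>
    have (x : {x : ℕ × ℕ // x ≠ 0}) :=
      isProbabilityMeasure_expMeasure (boundaryRate_pos ha hb (x : ℕ × ℕ))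
    have := HasIndepLaws.burke ih (p := ⟨(1, 0), by simp⟩) (q := ⟨(0, n + 1), by simp⟩)
      (s := ⟨(1, n + 1), by simp⟩) (by simp) (by simp) (by simp)
      (by simpa [boundaryRate] using measurePreserving_burkeMap ha hb hab)
    unfold IsExpFamily
    convert this using 2 with x
    ext ω
    simp only [StationaryCGM.columnUpdate, Subtype.ext_iff]

/-- After n updates, site (1,0) carries the horizontal increment between columns 0 and 1 at height
n, the first n sites of column 0 carry the increments along column 1, and the columns from 2 on are
untouched. This makes the next square's three inputs available. -/
lemma columnUpdate_eq {Ω : Type*} (w : ℕ × ℕ → Ω → ℝ) (ω : Ω) (n : ℕ) :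
    columnUpdate w n (1, 0) ω =
      lastPassage (fun x => w x ω) 1 n - lastPassage (fun x => w x ω) 0 n ∧
    (∀ j, columnUpdate w n (0, j + 1) ω = if j < n then
      lastPassage (fun x => w x ω) 1 (j + 1) - lastPassage (fun x => w x ω) 1 j
      else w (0, j + 1) ω) ∧
    (∀ i j, columnUpdate w n (i + 2, j) ω = w (i + 2, j) ω) ∧
    (∀ j, n ≤ j → columnUpdate w n (1, j + 1) ω = w (1, j + 1) ω) := by
  induction n with
  | zero =>
    refine ⟨?_, ?_, ?_, ?_⟩ <;> simp [columnUpdate, lastPassage_succ_zero _ 0]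
  | succ n ih =>
    obtain ⟨h1, h2, h3, h4⟩ := ih
    have hJ : columnUpdate w n (0, n + 1) ω =
      lastPassage (fun x => w x ω) 0 (n + 1) - lastPassage (fun x => w x ω) 0 n := by
      rw [h2, lastPassage_zero_succ]; simp
    have hG := lastPassage_succ_succ (fun x => w x ω) 0 n
    simp only [zero_add] at hG
    refine ⟨?_, fun j => ?_, fun i j => ?_, fun j hj => ?_⟩
    · simp only [columnUpdate, if_true, burkeMap]
      rw [h1, hJ, h4 n le_rfl, hG, sub_sub_sub_cancel_right, add_sub_right_comm,
        ← max_sub_sub_right, sub_self, max_comm, add_comm]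
    · rcases lt_trichotomy j n with hj | rfl | hj
      · simp only [columnUpdate, Prod.mk.injEq, add_left_inj, hj.ne, hj.trans (Nat.lt_succ_self n)]
        simp [h2, hj]
      · simp only [columnUpdate, burkeMap]
        rw [h1, hJ, h4 j le_rfl, hG, sub_sub_sub_cancel_right, add_sub_right_comm,
          ← max_sub_sub_right, sub_self]
        simp [add_comm]
      · simp only [columnUpdate, Prod.mk.injEq, add_left_inj, hj.ne']
        simp [h2, hj.not_ge, hj.not_gt]
    · simp [columnUpdate, h3]
    · have hjn : j ≠ n := by omega
      simp [columnUpdate, h4 j (by omega), hjn]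

lemma IsExpFamily.shiftWeights_right (h : IsExpFamily P (boundaryRate a b) w) (ha : 0 < a)
    (hb : 0 < b) (hab : a + b = 1) :
    IsExpFamily P (boundaryRate a b) (fun x ω => shiftWeights (1, 0) (fun y => w y ω) x) := by
  refine HasIndepLaws.of_finset (fun x => measurable_shiftWeights h.measurable_of_ne _ _)
    fun T => ?_
  -- Only finitely many updates are needed for finitely many sites: n is the largest height that
  -- occurs.
  set n := T.sup fun x => x.1.2 with hn
  have hg : ∀ x : ℕ × ℕ, x ≠ 0 → (if x.1 = 0 then x else (x.1 + 1, x.2)) ≠ 0 := by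
    intro x hx
    split_ifs
    exacts [hx, by simp]
  -- The model seen from (1,0) is read off by dropping column 1, which holds the dual weights and
  -- the last horizontal increment.
  have := HasIndepLaws.precomp (h.columnUpdate ha hb hab n)
    (g := fun x : T => ⟨if x.1.1.1 = 0 then x.1.1 else (x.1.1.1 + 1, x.1.1.2), hg _ x.1.2⟩) (by
      rintro ⟨⟨⟨i, j⟩, hx⟩, hT⟩ ⟨⟨⟨i', j'⟩, hx'⟩, hT'⟩ hxy
      simp only [Subtype.mk.injEq] at hxy ⊢
      split_ifs at hxy <;> simp_all)
  convert this using 2 with x x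
  · obtain ⟨⟨⟨i, j⟩, hx⟩, hT⟩ := x
    rcases eq_or_ne i 0 with rfl | hi <;> simp [boundaryRate, *]
  · obtain ⟨⟨⟨i, j⟩, hx⟩, hT⟩ := x
    have hjn : j ≤ n := Finset.le_sup (f := fun x : {x : ℕ × ℕ // x ≠ 0} => x.1.2) hT
    ext ω
    obtain ⟨h1, h2, h3, h4⟩ := columnUpdate_eq w ω n
    rcases i with _ | i
    · rcases j with _ | j
      · exact absurd rfl hx
      · simp [shiftWeights, h2, Nat.lt_of_succ_le hjn]
    · rcases j with _ | j
      · have := lastPassage_succ_zero (fun x => w x ω) (1 + i)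
        rw [show (1 + i + 1) = i + 2 by ring] at this
        simp [shiftWeights, h3, ← add_assoc]
        rw [show (1 + i + 1) = i + 2 by ring, this]
        ring
      · simp [shiftWeights, h3]
        rw [show (1 + (i + 1)) = i + 2 by ring]

lemma shiftWeights_shiftWeights (v v' : ℕ × ℕ) (w : ℕ × ℕ → ℝ) (x : ℕ × ℕ) :
    shiftWeights v' (shiftWeights v w) x = shiftWeights (v + v') w x := by
  obtain ⟨i, j⟩ := x
  rcases i with _ | i <;> rcases j with _ | j <;>
    simp [shiftWeights, lastPassage_shiftWeights, ← add_assoc]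

/-- The Burke property: the corner growth model seen from `v` is stationary. -/
lemma IsExpFamily.shiftWeights (h : IsExpFamily P (boundaryRate a b) w) (ha : 0 < a)
    (hb : 0 < b) (hab : a + b = 1) (v : ℕ × ℕ) :
    IsExpFamily P (boundaryRate a b) (fun x ω => shiftWeights v (fun y => w y ω) x) := by
  -- Upward shifts are right shifts of the reflected model with a and b exchanged.
  have hup : ∀ {w : ℕ × ℕ → Ω → ℝ}, IsExpFamily P (boundaryRate a b) w →
      IsExpFamily P (boundaryRate a b)
        (fun x ω => StationaryCGM.shiftWeights (0, 1) (fun y => w y ω) x) := by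
    intro w h
    have h1 := (h.swap.congr (fun x hx => boundaryRate_swap x hx)
      (fun _ _ => rfl)).shiftWeights_right hb ha (by linarith)
    refine h1.swap.congr (fun x hx => boundaryRate_swap x hx) fun x _ => ?_
    ext ω
    have := congrFun (shiftWeights_swap (fun y => w y ω) (0, 1)) x.swap
    simpa using this
  obtain ⟨p, q⟩ := v
  induction q with
  | zero =>
    induction p with
    | zero =>
      refine h.congr (fun _ _ => rfl) fun x hx => ?_
      obtain ⟨i, j⟩ := x
      ext ω
      rcases i with _ | i <;> rcases j with _ | j <;>
        simp_all [StationaryCGM.shiftWeights, lastPassage_succ_zero, lastPassage_zero_succ]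
    | succ p ih =>
      refine (ih.shiftWeights_right ha hb hab).congr (fun _ _ => rfl) fun x _ => ?_
      ext ω
      exact shiftWeights_shiftWeights _ _ _ _
  | succ q ih =>
    refine (hup ih).congr (fun _ _ => rfl) fun x _ => ?_
    ext ω
    exact shiftWeights_shiftWeights _ _ _ _

end

/-! ### Boundary tilts and the moment generating function -/

section

variable {Ω : Type*} [MeasurableSpace Ω] {P : Measure Ω} {w : ℕ × ℕ → Ω → ℝ} {a b : ℝ}

lemma lastPassage_right (w : ℕ × ℕ → ℝ) (m : ℕ) :
    lastPassage w m 0 = ∑ i ∈ Finset.range m, w (i + 1, 0) := by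
  induction m with
  | zero => simp
  | succ m ih => rw [lastPassage_succ_zero, ih, Finset.sum_range_succ]

lemma lastPassage_up (w : ℕ × ℕ → ℝ) (n : ℕ) :
    lastPassage w 0 n = ∑ j ∈ Finset.range n, w (0, j + 1) := by
  induction n with
  | zero => simp
  | succ m ih => rw [lastPassage_zero_succ, ih, Finset.sum_range_succ]

/-- The first `m` sites on the horizontal axis. -/
def horSites (m : ℕ) : Finset {x : ℕ × ℕ // x ≠ 0} :=
  (Finset.range m).map ⟨fun i => ⟨(i + 1, 0), by simp⟩, fun i j h => by simpa using h⟩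

/-- The first `n` sites on the vertical axis. -/
def verSites (n : ℕ) : Finset {x : ℕ × ℕ // x ≠ 0} :=
  (Finset.range n).map ⟨fun j => ⟨(0, j + 1), by simp⟩, fun i j h => by simpa using h⟩

lemma mem_map_horSites {m : ℕ} {x : ℕ × ℕ} :
    x ∈ (horSites m).map (Function.Embedding.subtype _) ↔ 0 < x.1 ∧ x.1 ≤ m ∧ x.2 = 0 := by
  obtain ⟨i, j⟩ := x
  simp only [horSites, Finset.map_map, Finset.mem_map, Finset.mem_range]
  constructor
  · rintro ⟨k, hk, h⟩
    have h1 : k + 1 = i := congrArg Prod.fst h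
    have h2 : 0 = j := congrArg Prod.snd h
    change 0 < i ∧ i ≤ m ∧ j = 0
    omega
  · rintro ⟨h1, h2, h3⟩
    change 0 < i at h1
    change i ≤ m at h2
    change j = 0 at h3
    refine ⟨i - 1, by omega, Prod.ext ?_ ?_⟩
    · change i - 1 + 1 = i
      omega
    · change 0 = j
      omega

lemma mem_map_verSites {n : ℕ} {x : ℕ × ℕ} :
    x ∈ (verSites n).map (Function.Embedding.subtype _) ↔ 0 < x.2 ∧ x.2 ≤ n ∧ x.1 = 0 := by
  obtain ⟨i, j⟩ := x
  simp only [verSites, Finset.map_map, Finset.mem_map, Finset.mem_range]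
  constructor
  · rintro ⟨k, hk, h⟩
    have h1 : 0 = i := congrArg Prod.fst h
    have h2 : k + 1 = j := congrArg Prod.snd h
    change 0 < j ∧ j ≤ n ∧ i = 0
    omega
  · rintro ⟨h1, h2, h3⟩
    change 0 < j at h1
    change j ≤ n at h2
    change i = 0 at h3
    refine ⟨j - 1, by omega, Prod.ext ?_ ?_⟩
    · change 0 = i
      omega
    · change j - 1 + 1 = j
      omega

lemma prod_ofReal_mul_exp {c θ : ℝ} (hc : 0 ≤ c) (f : ℕ → ℝ) (n : ℕ) :
    ∏ j ∈ Finset.range n, ENNReal.ofReal (c * Real.exp (θ * f j)) =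
      ENNReal.ofReal (c ^ n * Real.exp (θ * ∑ j ∈ Finset.range n, f j)) := by
  rw [← ENNReal.ofReal_prod_of_nonneg fun _ _ => by positivity, Finset.prod_mul_distrib,
    Finset.prod_const, Finset.card_range, ← Real.exp_sum, Finset.mul_sum]

/-- Change of the rate of the first `m` horizontal boundary weights. -/
lemma IsExpFamily.tilt_hor {r : ℕ × ℕ → ℝ} (h : IsExpFamily P r w) (hr : ∀ x, 0 < r x) (m : ℕ)
    (ha : 0 < a) (hb : 0 < b) (hra : ∀ i < m, r (i + 1, 0) = a) :
    IsExpFamily (P.withDensity fun ω => ENNReal.ofReal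
        ((b / a) ^ m * Real.exp ((a - b) * lastPassage (fun x => w x ω) m 0)))
      (fun x => if 0 < x.1 ∧ x.1 ≤ m ∧ x.2 = 0 then b else r x) w := by
  have := h.tilt hr (horSites m) (q := fun _ => b) (fun _ => hb)
  simp only [mem_map_horSites] at this
  convert this using 4 with ω
  rw [lastPassage_right, ← prod_ofReal_mul_exp (by positivity), horSites, Finset.prod_map]
  refine Finset.prod_congr rfl fun i hi => ?_
  change _ = ENNReal.ofReal (b / r (i + 1, 0) * Real.exp ((r (i + 1, 0) - b) * w (i + 1, 0) ω))
  rw [hra i (Finset.mem_range.1 hi)]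

lemma IsExpFamily.tilt_ver {r : ℕ × ℕ → ℝ} (h : IsExpFamily P r w) (hr : ∀ x, 0 < r x) (n : ℕ)
    (ha : 0 < a) (hb : 0 < b) (hra : ∀ i < n, r (0, i + 1) = a) :
    IsExpFamily (P.withDensity fun ω => ENNReal.ofReal
        ((b / a) ^ n * Real.exp ((a - b) * lastPassage (fun x => w x ω) 0 n)))
      (fun x => if 0 < x.2 ∧ x.2 ≤ n ∧ x.1 = 0 then b else r x) w := by
  have := h.tilt hr (verSites n) (q := fun _ => b) (fun _ => hb)
  simp only [mem_map_verSites] at this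
  convert this using 4 with ω
  rw [lastPassage_up, ← prod_ofReal_mul_exp (by positivity), verSites, Finset.prod_map]
  refine Finset.prod_congr rfl fun i hi => ?_
  change _ = ENNReal.ofReal (b / r (0, i + 1) * Real.exp ((r (0, i + 1) - b) * w (0, i + 1) ω))
  rw [hra i (Finset.mem_range.1 hi)]

/-- The moment generating function of the last-passage time with boundary rates `a`, `b` at
`a + b - 1`. -/
lemma IsExpFamily.lintegral_exp_lastPassage (h : IsExpFamily P (boundaryRate a b) w) (ha : 0 < a)
    (ha' : a < 1) (hb : 0 < b) (hb' : b < 1) (m n : ℕ) :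
    ∫⁻ ω, ENNReal.ofReal (Real.exp ((a + b - 1) * lastPassage (fun x => w x ω) m n)) ∂P =
      ENNReal.ofReal ((b / (1 - a)) ^ n * (a / (1 - b)) ^ m) := by
  have ha1 : 0 < 1 - a := by linarith
  have hb1 : 0 < 1 - b := by linarith
  -- Rescaling the vertical weights above height n does not affect G(m,n), and gives them rate 1-a,
  -- the rate that the tilt gives to the first n.
  set q : ℕ × ℕ → ℝ := fun x => if x.1 = 0 ∧ n < x.2 then b / (1 - a) else 1 with hq
  have hq0 : ∀ x, 0 < q x := by
    intro x
    simp only [hq]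
    split_ifs <;> positivity
  set W : ℕ × ℕ → Ω → ℝ := fun x ω => q x * w x ω with hW
  have hG : ∀ ω, lastPassage (fun x => w x ω) m n = lastPassage (fun x => W x ω) m n := by
    intro ω
    refine lpp_congr _ _ fun x _ hx => ?_
    simp [hW, hq, hx.not_gt]
  have hWf := h.scale (boundaryRate_pos ha hb) hq0
  have hr : ∀ x, 0 < boundaryRate a b x / q x :=
    fun x => div_pos (boundaryRate_pos ha hb x) (hq0 x)
  have hP' := hWf.tilt_ver (b := 1 - a) hr n hb ha1 (fun i hi => by
    simp [boundaryRate, hq, hi.not_ge])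
  set D : Ω → ENNReal := fun ω => ENNReal.ofReal
    (((1 - a) / b) ^ n * Real.exp ((b - (1 - a)) * lastPassage (fun x => W x ω) 0 n)) with hD
  have hstat : IsExpFamily (P.withDensity D) (boundaryRate a (1 - a)) W := by
    refine hP'.congr (fun x hx => ?_) (fun _ _ => rfl)
    obtain ⟨i, j⟩ := x
    rcases j with _ | j
    · simp_all [boundaryRate]
    · rcases i with _ | i
      · rcases Nat.lt_or_ge n (j + 1) with hj | hj
        · simp only [boundaryRate, hq]
          simp [hj, hj.not_ge]
          field_simp
        · simp [boundaryRate, hj]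
      · simp [boundaryRate, hq]
  have hWm := hstat.measurable_of_ne
  have hGm := measurable_lastPassage hWm
  -- Seen from (0,n) the tilted model is stationary, so the increments along row n can be tilted
  -- from rate a to 1-b. With H = G(0,n), the exponents (a+b-1)H and (a+b-1)(G-H) add up to
  -- (a+b-1)G.
  have hP'' := (hstat.shiftWeights ha ha1 (by ring) (0, n)).tilt_hor (b := 1 - b)
    (boundaryRate_pos ha ha1) m ha hb1 (fun i _ => by simp [boundaryRate])
  have h1 := hP''.isProbabilityMeasure.measure_univ
  rw [withDensity_apply _ .univ, Measure.restrict_univ, lintegral_withDensity_eq_lintegral_mul _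
    (by fun_prop) (by simp only [lastPassage_shiftWeights]; fun_prop)] at h1
  have h2 : ∀ ω, ENNReal.ofReal (Real.exp ((a + b - 1) * lastPassage (fun x => w x ω) m n)) =
      ENNReal.ofReal ((b / (1 - a)) ^ n * (a / (1 - b)) ^ m) *
      (D * fun ω => ENNReal.ofReal (((1 - b) / a) ^ m * Real.exp ((a - (1 - b)) *
        lastPassage (StationaryCGM.shiftWeights (0, n) fun y => W y ω) m 0))) ω := by
    intro ω
    rw [Pi.mul_apply, hD, ← ENNReal.ofReal_mul (by positivity), ← ENNReal.ofReal_mul (by positivity),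
      hG]
    congr 1
    rw [lastPassage_shiftWeights]
    simp only [zero_add, add_zero]
    set G := lastPassage (fun x => W x ω) m n
    set H := lastPassage (fun x => W x ω) 0 n
    have h3 : Real.exp ((a + b - 1) * G) =
        Real.exp ((b - (1 - a)) * H) * Real.exp ((a - (1 - b)) * (G - H)) := by
      rw [← Real.exp_add]; congr 1; ring
    have h4 : (b / (1 - a)) ^ n * ((1 - a) / b) ^ n = 1 := by
      rw [← mul_pow, div_mul_div_cancel₀ ha1.ne', div_self hb.ne', one_pow]
    have h5 : (a / (1 - b)) ^ m * ((1 - b) / a) ^ m = 1 := by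
      rw [← mul_pow, div_mul_div_cancel₀ hb1.ne', div_self ha.ne', one_pow]
    rw [h3]
    set E := Real.exp ((b - (1 - a)) * H)
    set E' := Real.exp ((a - (1 - b)) * (G - H))
    linear_combination (-(b / (1 - a)) ^ n * ((1 - a) / b) ^ n * E * E') * h5 - (E * E') * h4
  simp_rw [h2]
  rw [lintegral_const_mul _ (by simp only [lastPassage_shiftWeights]; fun_prop), h1, mul_one]

/-- Exponential tail bounds for the last-passage time: upper tail for `a + b > 1`, lower tail for
`a + b < 1`. -/
lemma IsExpFamily.measure_lastPassage_le (h : IsExpFamily P (boundaryRate a b) w) (ha : 0 < a)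
    (ha' : a < 1) (hb : 0 < b) (hb' : b < 1) (m n : ℕ) (L : ℝ) :
    P {ω | (a + b - 1) * L ≤ (a + b - 1) * lastPassage (fun x => w x ω) m n} ≤
      ENNReal.ofReal (Real.exp (n * (Real.log b - Real.log (1 - a)) +
        m * (Real.log a - Real.log (1 - b)) - (a + b - 1) * L)) := by
  have ha1 : 0 < 1 - a := by linarith
  have hb1 : 0 < 1 - b := by linarith
  have hGm := measurable_lastPassage h.measurable_of_ne m n
  have h1 := h.lintegral_exp_lastPassage ha ha' hb hb' m n
  have h2 := meas_ge_le_lintegral_div (μ := P) (f := fun ω => ENNReal.ofReal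
    (Real.exp ((a + b - 1) * lastPassage (fun x => w x ω) m n)))
    (Measurable.aemeasurable (by fun_prop)) (ε := ENNReal.ofReal (Real.exp ((a + b - 1) * L))) (by simp [Real.exp_pos]) (by simp)
  rw [h1, ← ENNReal.ofReal_div_of_pos (Real.exp_pos _)] at h2
  have h3 : (b / (1 - a)) ^ n * (a / (1 - b)) ^ m / Real.exp ((a + b - 1) * L) =
      Real.exp (n * (Real.log b - Real.log (1 - a)) + m * (Real.log a - Real.log (1 - b)) -
        (a + b - 1) * L) := by
    rw [← Real.log_div hb.ne' ha1.ne', ← Real.log_div ha.ne' hb1.ne', Real.exp_sub, Real.exp_add, Real.exp_nat_mul, Real.exp_nat_mul,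
      Real.exp_log (by positivity), Real.exp_log (by positivity)]
  rw [← h3]
  refine le_trans (measure_mono fun ω hω => ?_) h2
  exact ENNReal.ofReal_le_ofReal (Real.exp_le_exp.2 hω)

end

/-! ### Expansions of the logarithm -/

/-- First three terms of a series of one sign. The cubic term is kept because it is the whole gain
in `IsExpFamily.measure_lower_tail_le`. -/
lemma log_one_sub_le {y : ℝ} (h0 : 0 ≤ y) (h1 : y < 1) :
    Real.log (1 - y) ≤ -y - y ^ 2 / 2 - y ^ 3 / 3 := by
  have h := Real.hasSum_pow_div_log_of_abs_lt_one (x := y) (by rwa [abs_of_nonneg h0])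
  have := sum_le_hasSum (Finset.range 3) (fun i _ => by positivity) h
  norm_num [Finset.sum_range_succ] at this
  linarith

lemma le_log_one_sub {y : ℝ} (h0 : 0 ≤ y) (h1 : y ≤ 1 / 2) :
    -y - y ^ 2 / 2 - 2 * y ^ 3 ≤ Real.log (1 - y) := by
  have h := Real.abs_log_sub_add_sum_range_le (x := y) (by rw [abs_of_nonneg h0]; linarith) 2
  rw [abs_of_nonneg h0] at h
  have h2 : y ^ (2 + 1) / (1 - y) ≤ 2 * y ^ 3 := by
    rw [div_le_iff₀ (by linarith)]
    have := mul_nonneg (pow_nonneg h0 3) (by linarith : (0 : ℝ) ≤ 1 / 2 - y)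
    norm_num
    linarith
  have h3 := (abs_le.1 (h.trans h2)).1
  norm_num [Finset.sum_range_succ] at h3
  linarith

lemma le_log_one_add {z : ℝ} (h0 : 0 ≤ z) : z - z ^ 2 / 2 ≤ Real.log (1 + z) := by
  refine le_trans ?_ (Real.le_log_one_add_of_nonneg h0)
  rw [le_div_iff₀ (by linarith)]
  nlinarith [pow_nonneg h0 3]

lemma log_one_add_le {z : ℝ} (h0 : 0 ≤ z) (h1 : z ≤ 1 / 2) :
    Real.log (1 + z) ≤ z - z ^ 2 / 2 + 2 * z ^ 3 := by
  have h := Real.abs_log_sub_add_sum_range_le (x := -z)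
    (by rw [abs_neg, abs_of_nonneg h0]; linarith) 2
  rw [abs_neg, abs_of_nonneg h0] at h
  have h2 : z ^ (2 + 1) / (1 - z) ≤ 2 * z ^ 3 := by
    rw [div_le_iff₀ (by linarith)]
    have := mul_nonneg (pow_nonneg h0 3) (by linarith : (0 : ℝ) ≤ 1 / 2 - z)
    norm_num
    linarith
  have h3 := (abs_le.1 (h.trans h2)).2
  norm_num [Finset.sum_range_succ] at h3
  linarith

lemma log_mul_one_add {x t : ℝ} (hx : 0 < x) (ht : 0 < x + t) :
    Real.log (x + t) = Real.log x + Real.log (1 + t / x) := by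
  have h : x + t = x * (1 + t / x) := by field_simp
  have : 0 < 1 + t / x := by
    rw [h] at ht
    exact pos_of_mul_pos_right ht hx.le
  rw [← Real.log_mul hx.ne' this.ne', ← h]

lemma log_mul_one_sub {x t : ℝ} (hx : 0 < x) (ht : 0 < x - t) :
    Real.log (x - t) = Real.log x + Real.log (1 - t / x) := by
  have := log_mul_one_add (t := -t) hx (by linarith)
  rwa [← sub_eq_add_neg, neg_div, ← sub_eq_add_neg] at this

/-! ### Horizontal exit is unlikely above the characteristic direction -/

section

variable {Ω : Type*} [MeasurableSpace Ω] {P : Measure Ω} {w : ℕ × ℕ → Ω → ℝ} {a b α β : ℝ}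

lemma IsExpFamily.boundaryScale (h : IsExpFamily P (boundaryRate a b) w) (ha : 0 < a) (hb : 0 < b)
    (hα : 0 < α) (hβ : 0 < β) :
    IsExpFamily P (boundaryRate (a / α) (b / β)) (fun x ω => boundaryRate α β x * w x ω) :=
  (h.scale (boundaryRate_pos ha hb) (boundaryRate_pos hα hβ)).congr
    (fun x _ => by unfold boundaryRate; split_ifs <;> simp) fun _ _ => rfl

lemma horPassage_boundaryScale (u : ℕ × ℕ → ℝ) (α β β' : ℝ) :
    horPassage (fun x => boundaryRate α β x * u x) =
      horPassage (fun x => boundaryRate α β' x * u x) := by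
  simp [horPassage, boundaryRate]

lemma verPassage_boundaryScale (u : ℕ × ℕ → ℝ) (α α' β : ℝ) :
    verPassage (fun x => boundaryRate α β x * u x) =
      verPassage (fun x => boundaryRate α' β x * u x) := by
  simp [verPassage, boundaryRate]

lemma boundaryRate_one_one (x : ℕ × ℕ) : boundaryRate 1 1 x = 1 := by
  unfold boundaryRate; split_ifs <;> rfl

lemma horPassage_le_lastPassage (u : ℕ × ℕ → ℝ) (m n : ℕ) :
    horPassage u m (n + 1) ≤ lastPassage u (m + 1) (n + 1) := by
  rw [lastPassage_eq_max]; exact le_max_left _ _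

lemma verPassage_le_lastPassage (u : ℕ × ℕ → ℝ) (m n : ℕ) :
    verPassage u (m + 1) n ≤ lastPassage u (m + 1) (n + 1) := by
  rw [lastPassage_eq_max]; exact le_max_right _ _

lemma horPassage_mono {u u' : ℕ × ℕ → ℝ} (h : ∀ x, x ≠ 0 → u x ≤ u' x) (m n : ℕ) :
    horPassage u m n ≤ horPassage u' m n := lpp_mono (fun _ => h _ (by simp)) m n

lemma verPassage_mono {u u' : ℕ × ℕ → ℝ} (h : ∀ x, x ≠ 0 → u x ≤ u' x) (m n : ℕ) :
    verPassage u m n ≤ verPassage u' m n := lpp_mono (fun _ => h _ (by simp)) m n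

lemma one_le_boundaryRate (hα : 1 ≤ α) (hβ : 1 ≤ β) (x : ℕ × ℕ) : 1 ≤ boundaryRate α β x := by
  unfold boundaryRate; split_ifs <;> simp [*]

/-- Increasing the horizontal weights keeps horizontal exit optimal, so the first passage time
equals its horizontal part. That part does not see β and bounds the second passage time from below;
hence no level lies strictly between them in the wrong order. -/
lemma lastPassage_le_or_le_of_verPassage_le {u : ℕ × ℕ → ℝ} (hu : ∀ x, x ≠ 0 → 0 ≤ u x)
    (hα : 1 ≤ α) {m n : ℕ} (h : verPassage u (m + 1) n ≤ horPassage u m (n + 1)) (β L : ℝ) :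
    lastPassage (fun x => boundaryRate α 1 x * u x) (m + 1) (n + 1) ≤ L ∨
      L ≤ lastPassage (fun x => boundaryRate α β x * u x) (m + 1) (n + 1) := by
  by_contra! hcon
  obtain ⟨hn1, hn2⟩ := hcon
  rw [lastPassage_eq_max, horPassage_boundaryScale _ _ 1 β, verPassage_boundaryScale _ _ 1] at hn1
  simp only [boundaryRate_one_one, one_mul] at hn1
  have k1 := horPassage_le_lastPassage (fun x => boundaryRate α β x * u x) m n
  have k2 : horPassage u m (n + 1) ≤
      horPassage (fun x => boundaryRate α 1 x * u x) m (n + 1) := by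
    refine horPassage_mono (fun x hx => ?_) _ _
    nlinarith [hu x hx, one_le_boundaryRate hα (le_refl (1 : ℝ)) x]
  rw [horPassage_boundaryScale _ _ 1 β] at k2
  rcases lt_max_iff.1 hn1 with h | h <;> linarith

/-- In the stationary model, horizontal exit is unlikely when the endpoint `(m + 1, n + 1)` lies
above the characteristic direction. -/
lemma IsExpFamily.measure_verPassage_le_horPassage {c s : ℝ}
    (h : IsExpFamily P (boundaryRate c (1 - c)) w) (hc : 0 < c) (hc' : c < 1) (m n : ℕ)
    (hs : 0 < s) (hsc : 4 * s ≤ c) (hsc' : 4 * s ≤ 1 - c)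
    (hκ : 64 * ((m + 1) / c ^ 3 + (n + 1) / (1 - c) ^ 3) * s ≤
      (n + 1) / (1 - c) ^ 2 - (m + 1) / c ^ 2) :
    P {ω | verPassage (fun x => w x ω) (m + 1) n ≤ horPassage (fun x => w x ω) m (n + 1)} ≤
      ENNReal.ofReal (2 * Real.exp
        (-(((n + 1) / (1 - c) ^ 2 - (m + 1) / c ^ 2) * s ^ 2 / 4))) := by
  have hd : 0 < 1 - c := by linarith
  set d := 1 - c with hdd
  set κ : ℝ := (n + 1) / d ^ 2 - (m + 1) / c ^ 2 with hκd
  -- The shift κs balances the two tails: the quadratic part is κs²/2 - κs² in the first exponent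
  -- and -3κs²/2 + κs² in the second, both -κs²/2. The hypothesis on the cubic remainders leaves
  -- -κs²/4.
  set L : ℝ := (m + 1) / c + (n + 1) / d - κ * s with hL
  have hcs : 0 < c - s := by linarith
  -- Rates (c-s, d) give a+b-1 = -s, a lower tail; rates (c-s, d+2s) give a+b-1 = s, an upper tail.
  have h1 := h.boundaryScale hc hd (α := c / (c - s)) (β := 1) (by positivity) one_pos
  have h2 := h.boundaryScale hc hd (α := c / (c - s)) (β := d / (d + 2 * s)) (by positivity)
    (by positivity)
  rw [div_div_cancel₀ hc.ne', div_one] at h1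
  rw [div_div_cancel₀ hc.ne', div_div_cancel₀ hd.ne'] at h2
  have t1 := h1.measure_lastPassage_le hcs (by linarith) hd (by linarith) (m + 1) (n + 1) L
  have t2 := h2.measure_lastPassage_le hcs (by linarith) (by positivity) (by linarith)
    (m + 1) (n + 1) L
  set y := s / c with hy
  set z := s / d with hz
  have hy0 : 0 < y := by positivity
  have hz0 : 0 < z := by positivity
  have hy1 : y ≤ 1 / 4 := by rw [hy, div_le_iff₀ hc]; linarith
  have hz1 : z ≤ 1 / 4 := by rw [hz, div_le_iff₀ hd]; linarith
  have hκs : κ * s ^ 2 = (n + 1) * z ^ 2 - (m + 1) * y ^ 2 := by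
    rw [hκd, hy, hz]; field_simp
  have hκs' : 64 * ((m + 1) * y ^ 3 + (n + 1) * z ^ 3) ≤ κ * s ^ 2 := by
    have := mul_le_mul_of_nonneg_right hκ (sq_nonneg s)
    calc _ = 64 * ((m + 1) / c ^ 3 + (n + 1) / d ^ 3) * s * s ^ 2 := by
          rw [hy, hz]; field_simp
      _ ≤ _ := this
  have hsL : s * L = (m + 1) * y + (n + 1) * z - κ * s ^ 2 := by
    rw [hL, hy, hz]; field_simp
  have b1 := le_log_one_add hz0.le
  have b2 := log_one_sub_le hy0.le (by linarith)
  have b3 := log_one_add_le (z := 2 * z) (by linarith) (by linarith)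
  have b4 := le_log_one_sub (y := 2 * y) (by linarith) (by linarith)
  have l1 : Real.log (d + s) = Real.log d + Real.log (1 + z) := log_mul_one_add hd (by linarith)
  have l2 : Real.log (c - s) = Real.log c + Real.log (1 - y) := log_mul_one_sub hc hcs
  have l3 : Real.log (d + 2 * s) = Real.log d + Real.log (1 + 2 * z) := by
    rw [log_mul_one_add hd (by linarith), hz, mul_div_assoc]
  have l4 : Real.log (c - 2 * s) = Real.log c + Real.log (1 - 2 * y) := by
    rw [log_mul_one_sub hc (by linarith), hy, mul_div_assoc]
  have hm0 : (0 : ℝ) ≤ m + 1 := by positivity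
  have hn0 : (0 : ℝ) ≤ n + 1 := by positivity
  have b1 := mul_le_mul_of_nonneg_left b1 hn0
  have b2 := mul_le_mul_of_nonneg_left b2 hm0
  have b3 := mul_le_mul_of_nonneg_left b3 hn0
  have b4 := mul_le_mul_of_nonneg_left b4 hm0
  have hy3 : 0 ≤ (m + 1) * y ^ 3 := by positivity
  have hz3 : 0 ≤ (n + 1) * z ^ 3 := by positivity
  have e1 : ((n + 1 : ℕ) : ℝ) * (Real.log d - Real.log (1 - (c - s))) +
      ((m + 1 : ℕ) : ℝ) * (Real.log (c - s) - Real.log (1 - d)) - (c - s + d - 1) * L ≤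
      -(κ * s ^ 2 / 4) := by
    rw [show 1 - (c - s) = d + s by rw [hdd]; ring, show 1 - d = c by rw [hdd]; ring, l1, l2,
      show (c - s + d - 1) * L = - (s * L) by rw [hdd]; ring, hsL]
    push_cast
    linarith
  have e2 : ((n + 1 : ℕ) : ℝ) * (Real.log (d + 2 * s) - Real.log (1 - (c - s))) +
      ((m + 1 : ℕ) : ℝ) * (Real.log (c - s) - Real.log (1 - (d + 2 * s))) -
        (c - s + (d + 2 * s) - 1) * L ≤ -(κ * s ^ 2 / 4) := by
    rw [show 1 - (c - s) = d + s by rw [hdd]; ring,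
      show 1 - (d + 2 * s) = c - 2 * s by rw [hdd]; ring, l1, l2, l3, l4,
      show (c - s + (d + 2 * s) - 1) * L = s * L by rw [hdd]; ring, hsL]
    push_cast
    linarith
  have hP := h.isProbabilityMeasure
  have hsub : {ω | verPassage (fun x => w x ω) (m + 1) n ≤ horPassage (fun x => w x ω) m (n + 1)}
      ≤ᵐ[P] ({ω | (c - s + d - 1) * L ≤ (c - s + d - 1) *
          lastPassage (fun x => boundaryRate (c / (c - s)) 1 x * w x ω) (m + 1) (n + 1)} ∪
        {ω | (c - s + (d + 2 * s) - 1) * L ≤ (c - s + (d + 2 * s) - 1) *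
          lastPassage (fun x => boundaryRate (c / (c - s)) (d / (d + 2 * s)) x * w x ω)
            (m + 1) (n + 1)} : Set Ω) := by
    have hα : 1 ≤ c / (c - s) := (one_le_div hcs).2 (by linarith)
    filter_upwards [h.nonneg] with ω hω hle
    rcases lastPassage_le_or_le_of_verPassage_le hω hα hle
      (d / (d + 2 * s)) L with hL | hL
    · left
      change (c - s + d - 1) * L ≤ (c - s + d - 1) * _
      rw [show c - s + d - 1 = -s by rw [hdd]; ring, neg_mul, neg_mul]
      exact neg_le_neg (mul_le_mul_of_nonneg_left hL hs.le)
    · right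
      change (c - s + (d + 2 * s) - 1) * L ≤ (c - s + (d + 2 * s) - 1) * _
      rw [show c - s + (d + 2 * s) - 1 = s by rw [hdd]; ring]
      exact mul_le_mul_of_nonneg_left hL hs.le
  refine (measure_mono_ae hsub).trans ((measure_union_le _ _).trans ((add_le_add t1 t2).trans ?_))
  rw [← ENNReal.ofReal_add (Real.exp_pos _).le (Real.exp_pos _).le]
  refine ENNReal.ofReal_le_ofReal ?_
  have h3 := add_le_add (Real.exp_le_exp.2 e1) (Real.exp_le_exp.2 e2)
  rwa [← two_mul] at h3

end

/-! ### Crossings by geodesics and the upper bound -/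

lemma IsUpRightPath.le_succ {m n : ℕ} {π : ℕ → ℕ × ℕ} (h : IsUpRightPath m n π) {k : ℕ}
    (hk : k < m + n) : π k ≤ π (k + 1) := by
  rcases h.2.2 k hk with h' | h' <;> rw [h'] <;> simp

lemma IsUpRightPath.mono {m n : ℕ} {π : ℕ → ℕ × ℕ} (h : IsUpRightPath m n π) {j k : ℕ}
    (hjk : j ≤ k) (hk : k ≤ m + n) : π j ≤ π k := by
  induction k, hjk using Nat.le_induction with
  | base => exact le_rfl
  | succ k _ ih => exact (ih (by omega)).trans (h.le_succ (by omega))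

lemma IsUpRightPath.le_end {m n : ℕ} {π : ℕ → ℕ × ℕ} (h : IsUpRightPath m n π) {k : ℕ}
    (hk : k ≤ m + n) : π k ≤ (m, n) := h.2.1 ▸ h.mono hk le_rfl

/-- The first point of a path in the quadrant above `(p, q)` lies on its boundary. -/
lemma IsUpRightPath.exists_entry {m n : ℕ} {π : ℕ → ℕ × ℕ} (h : IsUpRightPath m n π) {p q : ℕ}
    (hp : p ≤ m) (hq : q ≤ n) :
    ∃ k ≤ m + n, (p ≤ (π k).1 ∧ q ≤ (π k).2) ∧ ((π k).1 = p ∨ (π k).2 = q) := by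
  classical
  have hex : ∃ k, p ≤ (π k).1 ∧ q ≤ (π k).2 := ⟨m + n, by rw [h.2.1]; exact ⟨hp, hq⟩⟩
  have hle : Nat.find hex ≤ m + n := Nat.find_min' hex (by rw [h.2.1]; exact ⟨hp, hq⟩)
  refine ⟨Nat.find hex, hle, Nat.find_spec hex, ?_⟩
  have hspec := Nat.find_spec hex
  rcases hk : Nat.find hex with _ | j
  · rw [hk, h.1] at hspec
    rw [h.1]
    left
    exact (Nat.le_zero.1 hspec.1).symm
  · have hmin := Nat.find_min hex (show j < Nat.find hex by omega)
    rw [hk] at hspec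
    have hstep := h.2.2 j (by omega)
    rcases hstep with h' | h' <;> rw [h'] at hspec ⊢ <;> simp at hspec ⊢ <;> omega

section

variable {Ω : Type*} [MeasurableSpace Ω] {P : Measure Ω} {w : ℕ × ℕ → Ω → ℝ} {c : ℝ}

/-- Cubic exponential bound for the horizontal exit when the endpoint deviates by about `S` from
the characteristic direction at scale `X`. -/
lemma IsExpFamily.measure_horizontal_exit_le {X S : ℝ}
    (h : IsExpFamily P (boundaryRate c (1 - c)) w) (hc : 0 < c) (hc' : c < 1) (m n : ℕ)
    (hSX : S ≤ X) (hS : 2 * (2 / (1 - c) ^ 2 + 1 / c ^ 2) ≤ S)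
    (hm : (m + 1 : ℝ) ≤ X * c ^ 2 - S + 1) (hn : (n + 1 : ℝ) ≤ X * (1 - c) ^ 2)
    (hn' : X * (1 - c) ^ 2 - 2 ≤ n + 1) :
    P {ω | verPassage (fun x => w x ω) (m + 1) n ≤ horPassage (fun x => w x ω) m (n + 1)} ≤
      ENNReal.ofReal (2 * Real.exp (-((c * (1 - c)) ^ 2 / 131072 * (S ^ 3 / X ^ 2)))) := by
  have hd : 0 < 1 - c := by linarith
  have hd' : 1 - c ≤ 1 := by linarith
  set d := 1 - c with hdd
  have hc1 : 1 ≤ 1 / c ^ 2 := (one_le_div (by positivity)).2 (pow_le_one₀ hc.le hc'.le)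
  have hd1 : 1 ≤ 1 / d ^ 2 := (one_le_div (by positivity)).2 (pow_le_one₀ hd.le hd')
  have hS1 : 1 ≤ S := by
    have : 2 / d ^ 2 = 2 * (1 / d ^ 2) := by ring
    linarith
  have hX : 0 < X := by linarith
  -- Chosen so that 64 · X/(cd) · s = S/2, which meets the cubic condition because κ ≥ S/2 and the
  -- cubic sum is at most X/(cd). Then κs²/4 has the constant 131072 = 8 · 128².
  set s := S * (c * d) / (128 * X) with hs
  have hs0 : 0 < s := by positivity
  have hscd : 128 * s ≤ c * d := by
    rw [hs, ← mul_div_assoc, div_le_iff₀ (by positivity)]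
    have : 0 ≤ c * d := by positivity
    nlinarith [mul_le_mul_of_nonneg_right hSX this]
  have hcd1 : c * d ≤ c := by nlinarith
  have hcd2 : c * d ≤ d := by nlinarith
  have hκ : S / 2 ≤ (n + 1) / d ^ 2 - (m + 1) / c ^ 2 := by
    have h1 : X - 2 / d ^ 2 ≤ (n + 1) / d ^ 2 := by
      rw [le_div_iff₀ (by positivity), sub_mul, div_mul_cancel₀ _ (by positivity)]
      exact hn'
    have h2 : (m + 1) / c ^ 2 ≤ X - (S - 1) / c ^ 2 := by
      rw [div_le_iff₀ (by positivity), sub_mul, div_mul_cancel₀ _ (by positivity)]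
      linarith
    have h3 : S - 1 / c ^ 2 ≤ (S - 1) / c ^ 2 := by
      rw [sub_div]
      have : S * 1 ≤ S * (1 / c ^ 2) := by gcongr
      have h4 : S * (1 / c ^ 2) = S / c ^ 2 := by ring
      linarith
    linarith
  have hB : (m + 1) / c ^ 3 + (n + 1) / d ^ 3 ≤ X / (c * d) := by
    have h1 : (m + 1) / c ^ 3 ≤ X / c := by
      rw [div_le_div_iff₀ (by positivity) hc]
      have : (m + 1 : ℝ) ≤ X * c ^ 2 := by linarith
      calc _ ≤ X * c ^ 2 * c := by gcongr
        _ = _ := by ring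
    have h2 : (n + 1) / d ^ 3 ≤ X / d := by
      rw [div_le_div_iff₀ (by positivity) hd]
      calc _ ≤ X * d ^ 2 * d := by gcongr
        _ = _ := by ring
    have h3 : X / c + X / d = X / (c * d) := by
      rw [div_add_div _ _ hc.ne' hd.ne']
      congr 1
      rw [hdd]
      ring
    linarith
  have hBs : 64 * ((m + 1) / c ^ 3 + (n + 1) / d ^ 3) * s ≤ (n + 1) / d ^ 2 - (m + 1) / c ^ 2 := by
    refine le_trans ?_ hκ
    calc _ ≤ 64 * (X / (c * d)) * s := by gcongr
      _ = S / 2 := by rw [hs]; field_simp; norm_num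
  refine (h.measure_verPassage_le_horPassage hc hc' m n hs0 (by linarith) (by linarith) hBs).trans ?_
  refine ENNReal.ofReal_le_ofReal ?_
  gcongr
  calc _ = S / 2 * s ^ 2 / 4 := by rw [hs]; field_simp; norm_num
    _ ≤ _ := by gcongr

/-- A geodesic is unlikely to cross the height `⌈t n⌉` beyond distance `S` to the right. -/
lemma IsExpFamily.measure_right_crossing_le {N t S : ℝ}
    (h : IsExpFamily P (boundaryRate c (1 - c)) w) (hc : 0 < c) (hc' : c < 1)
    (ht0 : 0 ≤ t) (ht1 : t < 1) (hN : 0 < N) (hSX : S ≤ (1 - t) * N)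
    (hS : 2 * (2 / (1 - c) ^ 2 + 1 / c ^ 2) ≤ S) (m n : ℕ) (hm : m = ⌊N * c ^ 2⌋₊)
    (hn : n = ⌊N * (1 - c) ^ 2⌋₊) :
    P {ω | ∃ π, IsGeodesic (fun x => w x ω) m n π ∧
        ∃ k ≤ m + n, t * m + S < (π k).1 ∧ (π k).2 = ⌈t * n⌉₊} ≤
      ENNReal.ofReal (2 * Real.exp
        (-((c * (1 - c)) ^ 2 / 131072 * (S ^ 3 / ((1 - t) * N) ^ 2)))) := by
  have hd : 0 < 1 - c := by linarith
  set d := 1 - c with hdd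
  set X := (1 - t) * N with hX
  have h1t : 0 < 1 - t := by linarith
  have hS0 : 4 / d ^ 2 ≤ S := by
    have : 0 < 1 / c ^ 2 := by positivity
    have h2 : 4 / d ^ 2 = 2 * (2 / d ^ 2) := by ring
    linarith
  have hXd : 4 ≤ X * d ^ 2 := by
    rw [← div_le_iff₀ (by positivity)]
    linarith
  have hSpos : 0 ≤ S := le_trans (by positivity) hS0
  have hmN : (m : ℝ) ≤ N * c ^ 2 := by rw [hm]; exact Nat.floor_le (by positivity)
  have hnN : (n : ℝ) ≤ N * d ^ 2 := by rw [hn]; exact Nat.floor_le (by positivity)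
  have hnN' : N * d ^ 2 < n + 1 := by rw [hn]; exact Nat.lt_floor_add_one _
  have hv1 : (⌊t * m + S⌋₊ : ℝ) ≤ t * m + S := Nat.floor_le (by positivity)
  have hv1' : t * m + S < ⌊t * m + S⌋₊ + 1 := Nat.lt_floor_add_one _
  have hv2 : t * n ≤ ⌈t * n⌉₊ := Nat.le_ceil _
  have hv2' : (⌈t * n⌉₊ : ℝ) < t * n + 1 := Nat.ceil_lt_add_one (by positivity)
  -- The geodesic crosses the horizontal axis through v strictly to its right. Seen from v the
  -- endpoint is near ((1-t)m - S, (1-t)n), a displacement S at scale X = (1-t)N.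
  set v : ℕ × ℕ := (⌊t * m + S⌋₊, ⌈t * n⌉₊) with hv
  have hXn : (1 - t) * n ≤ X * d ^ 2 := by
    calc _ ≤ (1 - t) * (N * d ^ 2) := by gcongr
      _ = _ := by rw [hX]; ring
  have hXn' : X * d ^ 2 - 1 ≤ (1 - t) * n := by
    have : (1 - t) * (N * d ^ 2) ≤ (1 - t) * (n + 1) := by gcongr
    have h3 : (1 - t) * (N * d ^ 2) = X * d ^ 2 := by rw [hX]; ring
    nlinarith
  have hXm : (1 - t) * m ≤ X * c ^ 2 := by
    calc _ ≤ (1 - t) * (N * c ^ 2) := by gcongr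
      _ = _ := by rw [hX]; ring
  have hn1 : v.2 + 1 ≤ n := by
    have : (v.2 : ℝ) < n := by
      change (⌈t * n⌉₊ : ℝ) < n
      linarith
    exact_mod_cast this
  obtain ⟨n', hn'⟩ := Nat.exists_eq_add_of_le hn1
  rcases Nat.lt_or_ge v.1 m with hm1 | hm1
  · obtain ⟨m', hm'⟩ := Nat.exists_eq_add_of_le (Nat.succ_le_of_lt hm1)
    have hmr : (m : ℝ) = ⌊t * m + S⌋₊ + 1 + m' := by exact_mod_cast hm'
    have hnr : (n : ℝ) = ⌈t * n⌉₊ + 1 + n' := by exact_mod_cast hn'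
    refine le_trans (measure_mono ?_) ((h.shiftWeights hc hd (by rw [hdd]; ring)
      v).measure_horizontal_exit_le hc hc' m' n' hSX hS (by linarith) (by linarith) (by linarith))
    rintro ω ⟨π, hπ, k, hk, hk1, hk2⟩
    have hm'' : m = v.1 + (m' + 1) := by omega
    have hn'' : n = v.2 + (n' + 1) := by omega
    have hk1' : v.1 < (π k).1 := by
      have : (v.1 : ℝ) < (π k).1 := lt_of_le_of_lt hv1 hk1
      exact_mod_cast this
    obtain ⟨i, hi⟩ := Nat.exists_eq_add_of_le (Nat.succ_le_of_lt hk1')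
    clear_value v
    have hk3 : (π k).2 = v.2 := by rw [hk2, hv]
    clear hv hv1 hv1' hv2 hv2' hk1 hk2 hmr hnr hm' hn' hm1 hn1 hXn hXn' hXm hmN hnN hnN' hm hn
    subst hm'' hn''
    exact hπ.verPassage_le_horPassage (k₀ := k) (i := i) hk
      (Prod.ext (by simp only; omega) hk3)
  -- Here v is not to the left of the endpoint, so no path can pass to its right.
  · have : {ω | ∃ π, IsGeodesic (fun x => w x ω) m n π ∧
        ∃ k ≤ m + n, t * m + S < (π k).1 ∧ (π k).2 = ⌈t * n⌉₊} = ∅ := by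
      ext ω
      simp only [Set.mem_empty_iff_false, iff_false]
      rintro ⟨π, hπ, k, hk, hk1, -⟩
      have h1 : (π k).1 ≤ m := (hπ.1.le_end hk).1
      have h2 : (v.1 : ℝ) < (π k).1 := lt_of_le_of_lt hv1 hk1
      have h3 : v.1 < (π k).1 := by exact_mod_cast h2
      omega
    rw [this, measure_empty]
    exact bot_le

end

/-- A path that misses the square enters the quadrant at its corner far to the right or far up. -/
lemma IsUpRightPath.crossing_of_misses {m n : ℕ} {π : ℕ → ℕ × ℕ} (h : IsUpRightPath m n π)
    {t S : ℝ} (ht0 : 0 ≤ t) (ht1 : t ≤ 1) (hS : 1 ≤ S)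
    (hmiss : Misses m n π (square S (t * m, t * n))) :
    (∃ k ≤ m + n, t * m + S < (π k).1 ∧ (π k).2 = ⌈t * n⌉₊) ∨
      (∃ k ≤ m + n, t * n + S < (π k).2 ∧ (π k).1 = ⌈t * m⌉₊) := by
  have hp : ⌈t * m⌉₊ ≤ m := Nat.ceil_le.2 (mul_le_of_le_one_left (by positivity) ht1)
  have hq : ⌈t * n⌉₊ ≤ n := Nat.ceil_le.2 (mul_le_of_le_one_left (by positivity) ht1)
  have hp' : (⌈t * m⌉₊ : ℝ) < t * m + 1 := Nat.ceil_lt_add_one (by positivity)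
  have hq' : (⌈t * n⌉₊ : ℝ) < t * n + 1 := Nat.ceil_lt_add_one (by positivity)
  obtain ⟨k, hk, ⟨h1, h2⟩, h3⟩ := h.exists_entry hp hq
  have hm := hmiss k hk
  simp only [square] at hm
  have h1' := Nat.ceil_le.1 h1
  have h2' := Nat.ceil_le.1 h2
  rcases h3 with h3 | h3
  · right
    refine ⟨k, hk, ?_, h3⟩
    by_contra! hcon
    refine hm ⟨⟨h1', ?_⟩, ⟨h2', hcon⟩⟩
    simp only
    rw [h3]
    linarith
  · left
    refine ⟨k, hk, ?_, h3⟩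
    by_contra! hcon
    refine hm ⟨⟨h1', hcon⟩, ⟨h2', ?_⟩⟩
    simp only
    rw [h3]
    linarith

lemma exp_neg_le_inv {y : ℝ} (hy : 0 < y) : Real.exp (-y) ≤ 1 / y := by
  rw [Real.exp_neg, one_div]
  gcongr
  linarith [Real.add_one_le_exp y]

/-- Upper bound for the probability that a geodesic misses the square. -/
lemma measure_someGeodesicMisses_le (ρ : ℝ) (hρ0 : 0 < ρ) (hρ1 : ρ < 1) :
    ∃ C : ℝ, 0 < C ∧
      ∀ (Ω : Type*) [MeasurableSpace Ω] (P : Measure Ω) [IsProbabilityMeasure P]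
        (w : ℕ × ℕ → Ω → ℝ), IsWeightFamily P ρ w →
        ∀ δ : ℝ, 0 < δ → δ < 1 → ∀ r : ℝ, 1 ≤ r → ∀ N : ℝ, 1 / δ ≤ N →
        ∀ t : ℝ, 0 ≤ t → t ≤ 1 - δ →
          P.real (someGeodesicMisses w ρ N t (r * N ^ (2 / 3 : ℝ))) ≤ C / r ^ 3 := by
  have hd : 0 < 1 - ρ := by linarith
  set A := (ρ * (1 - ρ)) ^ 2 / 131072 with hA
  have hA0 : 0 < A := by positivity
  set S₀ := 4 * (1 / (1 - ρ) ^ 2 + 1 / ρ ^ 2) with hS₀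
  have hS₀0 : 0 < S₀ := by positivity
  refine ⟨4 / A + S₀ ^ 3, by positivity, ?_⟩
  intro Ω _ P _ w hw δ hδ0 hδ1 r hr N hN t ht0 ht
  have hr0 : 0 < r := by linarith
  have hN1 : 1 < N := lt_of_lt_of_le ((one_lt_div hδ0).2 hδ1) hN
  have hN0 : 0 < N := by linarith
  have ht1 : t < 1 := by linarith
  -- For r < S₀ the summand S₀³ of the constant makes the bound trivial. For r ≥ S₀ the side
  -- conditions on S hold in both orientations.
  rcases lt_or_ge r S₀ with hrS | hrS
  · refine measureReal_le_one.trans ?_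
    rw [one_le_div (by positivity)]
    have : r ^ 3 ≤ S₀ ^ 3 := by gcongr
    have h4 : 0 < 4 / A := by positivity
    linarith
  set S := r * N ^ (2 / 3 : ℝ) with hS
  have hN23 : 1 ≤ N ^ (2 / 3 : ℝ) := Real.one_le_rpow hN1.le (by norm_num)
  have hrS' : r ≤ S := by rw [hS]; nlinarith
  have hS3 : S ^ 3 = r ^ 3 * N ^ 2 := by
    rw [hS, mul_pow, ← Real.rpow_natCast (N ^ (2 / 3 : ℝ)), ← Real.rpow_mul hN0.le]
    norm_num
  set m := endX ρ N with hm
  set n := endY ρ N with hn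
  have hmN : (m : ℝ) ≤ N * (1 - ρ) ^ 2 := Nat.floor_le (by positivity)
  have hnN : (n : ℝ) ≤ N * ρ ^ 2 := Nat.floor_le (by positivity)
  -- If the square is larger than the remaining distance it contains the endpoint, which every path
  -- visits.
  rcases lt_or_ge ((1 - t) * N) S with hSX | hSX
  · have : someGeodesicMisses w ρ N t S = ∅ := by
      ext ω
      simp only [Set.mem_empty_iff_false, iff_false]
      rintro ⟨π, hπ, hmiss⟩
      refine hmiss _ le_rfl ?_
      rw [hπ.1.2.1]
      have h1t : 0 < 1 - t := by linarith
      have hm' : (1 - t) * m ≤ (1 - t) * N := by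
        gcongr
        exact hmN.trans (mul_le_of_le_one_right hN0.le (pow_le_one₀ hd.le (by linarith)))
      have hn' : (1 - t) * n ≤ (1 - t) * N := by
        gcongr
        exact hnN.trans (mul_le_of_le_one_right hN0.le (pow_le_one₀ hρ0.le hρ1.le))
      have hm0 : (0 : ℝ) ≤ m := by positivity
      have hn0 : (0 : ℝ) ≤ n := by positivity
      refine ⟨⟨?_, ?_⟩, ⟨?_, ?_⟩⟩ <;> simp only <;> nlinarith
    rw [this, measureReal_empty]
    positivity
  · have hfam := hw.isExpFamily
    have hfam1 : IsExpFamily P (boundaryRate (1 - ρ) (1 - (1 - ρ))) w := by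
      rwa [sub_sub_cancel]
    have hfam2 : IsExpFamily P (boundaryRate ρ (1 - ρ)) fun x => w x.swap :=
      hfam.swap.congr (fun x hx => boundaryRate_swap x hx) fun _ _ => rfl
    have hS1 : 2 * (2 / (1 - (1 - ρ)) ^ 2 + 1 / (1 - ρ) ^ 2) ≤ S := by
      refine le_trans ?_ (hrS.trans hrS')
      rw [sub_sub_cancel, hS₀, show 2 / ρ ^ 2 = 2 * (1 / ρ ^ 2) by ring]
      have : 0 < 1 / (1 - ρ) ^ 2 := by positivity
      linarith
    have hS2 : 2 * (2 / (1 - ρ) ^ 2 + 1 / ρ ^ 2) ≤ S := by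
      refine le_trans ?_ (hrS.trans hrS')
      rw [hS₀, show 2 / (1 - ρ) ^ 2 = 2 * (1 / (1 - ρ) ^ 2) by ring]
      have : 0 < 1 / ρ ^ 2 := by positivity
      linarith
    have b1 := hfam1.measure_right_crossing_le hd (by linarith) ht0 ht1 hN0 hSX hS1 m n rfl
      (by rw [sub_sub_cancel]; rfl)
    have b2 := hfam2.measure_right_crossing_le hρ0 hρ1 ht0 ht1 hN0 hSX hS2 n m rfl rfl
    rw [sub_sub_cancel, mul_comm (1 - ρ) ρ, ← hA] at b1
    rw [← hA] at b2
    have hbound : 2 * Real.exp (-(A * (S ^ 3 / ((1 - t) * N) ^ 2))) ≤ 2 / (A * r ^ 3) := by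
      have h1t : 0 < 1 - t := by linarith
      have h1 : r ^ 3 ≤ S ^ 3 / ((1 - t) * N) ^ 2 := by
        rw [le_div_iff₀ (by positivity), hS3]
        gcongr
        nlinarith
      calc _ ≤ 2 * Real.exp (-(A * r ^ 3)) := by gcongr
        _ ≤ 2 * (1 / (A * r ^ 3)) := by gcongr; exact exp_neg_le_inv (by positivity)
        _ = _ := by ring
    have hsub : someGeodesicMisses w ρ N t S ⊆
        {ω | ∃ π, IsGeodesic (fun x => w x ω) m n π ∧
          ∃ k ≤ m + n, t * m + S < (π k).1 ∧ (π k).2 = ⌈t * n⌉₊} ∪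
        {ω | ∃ π, IsGeodesic (fun x => w x.swap ω) n m π ∧
          ∃ k ≤ n + m, t * n + S < (π k).1 ∧ (π k).2 = ⌈t * m⌉₊} := by
      rintro ω ⟨π, hπ, hmiss⟩
      rcases hπ.1.crossing_of_misses ht0 ht1.le (hr.trans hrS') hmiss with hk | ⟨k, hk, h1, h2⟩
      · exact Or.inl ⟨π, hπ, hk⟩
      · exact Or.inr ⟨_, hπ.swap, k, by omega, h1, h2⟩
    have hfin : P (someGeodesicMisses w ρ N t S) ≤ ENNReal.ofReal ((4 / A + S₀ ^ 3) / r ^ 3) := by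
      refine (measure_mono hsub).trans ((measure_union_le _ _).trans ((add_le_add b1 b2).trans ?_))
      rw [← ENNReal.ofReal_add (by positivity) (by positivity)]
      refine ENNReal.ofReal_le_ofReal ?_
      have h4 : 4 / A / r ^ 3 = 2 / (A * r ^ 3) + 2 / (A * r ^ 3) := by field_simp; norm_num
      have h5 : 0 ≤ S₀ ^ 3 / r ^ 3 := by positivity
      rw [add_div, h4]
      linarith
    exact ENNReal.toReal_le_of_le_ofReal (by positivity) hfin

/-! ### Tail bounds and deterministic input for the lower bound -/

section

variable {Ω : Type*} [MeasurableSpace Ω] {P : Measure Ω} {w : ℕ × ℕ → Ω → ℝ} {c s : ℝ}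

/-- Chernoff with a+b-1 = -s. Raising the horizontal weights pushes G above its value m/c + n/(1-c)
on the stationary scale by order m s²: the negative cubic term leaves room for a positive Λ of that
size. -/
lemma IsExpFamily.measure_lower_tail_le (h : IsExpFamily P (boundaryRate (c - s) (1 - c)) w)
    (hc' : c < 1) (hs : 0 < s) (hsc : s < c) (m n : ℕ) (Λ : ℝ) :
    P {ω | lastPassage (fun x => w x ω) m n ≤ m / c + n / (1 - c) + Λ} ≤
      ENNReal.ofReal (Real.exp ((n / (1 - c) ^ 2 - m / c ^ 2) * s ^ 2 / 2 -
        m * (s / c) ^ 3 / 3 + s * Λ)) := by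
  have hc : 0 < c := by linarith
  have hd : 0 < 1 - c := by linarith
  have hcs : 0 < c - s := by linarith
  set L := m / c + n / (1 - c) + Λ with hL
  have h1 := h.measure_lastPassage_le hcs (by linarith) hd (by linarith) m n L
  rw [show c - s + (1 - c) - 1 = -s by ring, show 1 - (c - s) = (1 - c) + s by ring,
    sub_sub_cancel] at h1
  refine (measure_mono fun ω hω => ?_).trans (h1.trans (ENNReal.ofReal_le_ofReal ?_))
  · change -s * L ≤ -s * _
    rw [neg_mul, neg_mul]
    exact neg_le_neg (mul_le_mul_of_nonneg_left hω hs.le)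
  · rw [Real.exp_le_exp, log_mul_one_add hd (by linarith), log_mul_one_sub hc hcs]
    have hy1 : s / c < 1 := by rwa [div_lt_one hc]
    have b1 := mul_le_mul_of_nonneg_left (le_log_one_add (z := s / (1 - c)) (by positivity))
      (Nat.cast_nonneg (α := ℝ) n)
    have b2 := mul_le_mul_of_nonneg_left (log_one_sub_le (y := s / c) (by positivity) hy1)
      (Nat.cast_nonneg (α := ℝ) m)
    have e1 : -s * L = -(m * (s / c) + n * (s / (1 - c)) + s * Λ) := by rw [hL]; ring
    have e2 : (n / (1 - c) ^ 2 - m / c ^ 2) * s ^ 2 / 2 =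
      n * (s / (1 - c)) ^ 2 / 2 - m * (s / c) ^ 2 / 2 := by simp only [div_pow]; ring
    rw [e1, e2]
    linarith

/-- Chernoff with a+b-1 = s. It will control the vertical optimum, which does not see the lowered
horizontal weights. -/
lemma IsExpFamily.measure_upper_tail_le (h : IsExpFamily P (boundaryRate (c + s) (1 - c)) w)
    (hs : 0 < s) (hsc : 2 * s ≤ c) (hsd : 2 * s ≤ 1 - c) (m n : ℕ) (Λ : ℝ) :
    P {ω | m / c + n / (1 - c) + Λ ≤ lastPassage (fun x => w x ω) m n} ≤
      ENNReal.ofReal (Real.exp ((n / (1 - c) ^ 2 - m / c ^ 2) * s ^ 2 / 2 +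
        2 * (m / c ^ 3 + n / (1 - c) ^ 3) * s ^ 3 - s * Λ)) := by
  have hc : 0 < c := by linarith
  have hd : 0 < 1 - c := by linarith
  set L := m / c + n / (1 - c) + Λ with hL
  have h1 := h.measure_lastPassage_le (by positivity) (by linarith) hd (by linarith) m n L
  rw [show c + s + (1 - c) - 1 = s by ring, show 1 - (c + s) = (1 - c) - s by ring,
    sub_sub_cancel] at h1
  refine (measure_mono fun ω hω => ?_).trans (h1.trans (ENNReal.ofReal_le_ofReal ?_))
  · exact mul_le_mul_of_nonneg_left hω hs.le
  · rw [Real.exp_le_exp, log_mul_one_sub hd (by linarith), log_mul_one_add hc (by linarith)]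
    have hy1 : s / c ≤ 1 / 2 := by rw [div_le_iff₀ hc]; linarith
    have hz1 : s / (1 - c) ≤ 1 / 2 := by rw [div_le_iff₀ hd]; linarith
    have b1 := mul_le_mul_of_nonneg_left (le_log_one_sub (y := s / (1 - c)) (by positivity) hz1)
      (Nat.cast_nonneg (α := ℝ) n)
    have b2 := mul_le_mul_of_nonneg_left (log_one_add_le (z := s / c) (by positivity) hy1)
      (Nat.cast_nonneg (α := ℝ) m)
    have e1 : s * L = m * (s / c) + n * (s / (1 - c)) + s * Λ := by rw [hL]; ring
    have e2 : (n / (1 - c) ^ 2 - m / c ^ 2) * s ^ 2 / 2 =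
      n * (s / (1 - c)) ^ 2 / 2 - m * (s / c) ^ 2 / 2 := by simp only [div_pow]; ring
    have e3 : 2 * (m / c ^ 3 + n / (1 - c) ^ 3) * s ^ 3 =
      2 * (m * (s / c) ^ 3) + 2 * (n * (s / (1 - c)) ^ 3) := by simp only [div_pow]; ring
    rw [e1, e2, e3]
    linarith

end

/-- A sufficient condition for horizontal exit in terms of the truncated boundary weights. -/
lemma verPassage_lt_horPassage_of {u W : ℕ × ℕ → ℝ} (hW : ∀ x, x ≠ 0 → 0 ≤ W x) {l m n : ℕ}
    (hu : ∀ x, x ≠ 0 → (x.2 ≠ 0 ∨ x.1 ≤ l) → u x = W x) {α β L : ℝ} (hβ : β ≤ 1)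
    (h1 : lastPassage (fun x => boundaryRate α 1 x * W x) (l + m + 1) (n + 1) < L)
    (h2 : L < lastPassage W (l + m + 1) (n + 1))
    (h3 : horPassage (shiftWeights (l, 0) fun x => boundaryRate 1 β x * W x) m (n + 1) <
      verPassage (shiftWeights (l, 0) fun x => boundaryRate 1 β x * W x) (m + 1) n) :
    verPassage u (l + m + 1) n < horPassage u (l + m) (n + 1) := by
  set W₃ : ℕ × ℕ → ℝ := fun x => boundaryRate 1 β x * W x with hW₃
  have hver : verPassage u = verPassage W := by
    have : (fun x : ℕ × ℕ => u (x.1, x.2 + 1)) = fun x => W (x.1, x.2 + 1) := by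
      ext x
      exact hu _ (by simp) (Or.inl (by simp))
    rw [verPassage, verPassage, this]
  have hV : verPassage W (l + m + 1) n < L := by
    have := verPassage_le_lastPassage (fun x => boundaryRate α 1 x * W x) (l + m) n
    rw [verPassage_boundaryScale _ α 1] at this
    simp only [boundaryRate_one_one, one_mul] at this
    linarith
  -- W₃ differs from W only on the vertical axis.
  have hhor : horPassage W₃ = horPassage W := by
    rw [hW₃, horPassage_boundaryScale _ _ _ 1]
    simp only [boundaryRate_one_one, one_mul]
  have hV₃ : verPassage W₃ (l + m + 1) n ≤ verPassage W (l + m + 1) n := by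
    refine verPassage_mono (fun x hx => ?_) _ _
    have : boundaryRate 1 β x ≤ 1 := by unfold boundaryRate; split_ifs <;> simp [hβ]
    nlinarith [hW x hx]
  have hM : L < horPassage W (l + m) (n + 1) := by
    rw [lastPassage_eq_max] at h2
    rcases lt_max_iff.1 h2 with h | h <;> linarith
  have hsplit := lastPassage_shiftWeights W₃ (l, 0) (m + 1) (n + 1)
  simp only [zero_add, ← add_assoc] at hsplit
  rw [lastPassage_eq_max (shiftWeights (l, 0) W₃)] at hsplit
  rw [lastPassage_eq_max, hhor] at hsplit
  -- Paths that run along the axis beyond l are strictly worse than the W₃ optimum from (l,0). Since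
  -- that optimum from 0 is horizontal and equals the one for W, truncating the modified weights at
  -- l costs nothing.
  have hmax := lt_of_lt_of_le h3 (le_max_right (horPassage (shiftWeights (l, 0) W₃) m (n + 1)) _)
  have hcut := horPassage_le_max (w := W) (w' := u) hu m (n + 1)
  have hhs : horPassage (shiftWeights (l, 0) W) = horPassage (shiftWeights (l, 0) W₃) := by
    have : (fun x : ℕ × ℕ => shiftWeights (l, 0) W (x.1 + 1, x.2)) =
        fun x => shiftWeights (l, 0) W₃ (x.1 + 1, x.2) := by
      ext ⟨i, j⟩
      rcases j with _ | j
      · simp [shiftWeights, lastPassage_right, hW₃, boundaryRate]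
      · simp [shiftWeights, hW₃, boundaryRate]
    rw [horPassage, horPassage, this]
  have hS : lastPassage W l 0 = lastPassage W₃ l 0 := by
    simp [lastPassage_right, hW₃, boundaryRate]
  rw [hhs, hS] at hcut
  rw [hver]
  rcases le_max_iff.1 hcut with h | h
  · linarith
  · have h4 : horPassage W (l + m) (n + 1) <
        max (horPassage W (l + m) (n + 1)) (verPassage W₃ (l + m + 1) n) := by linarith
    rcases lt_max_iff.1 h4 with h5 | h5 <;> linarith

/-- Lower bound for a probability after a change of measure with square integrable density. -/
lemma le_measure_of_withDensity {Ω : Type*} [MeasurableSpace Ω] {P : Measure Ω}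
    {f : Ω → ℝ} (hf : Measurable f) (hf0 : ∀ ω, 0 ≤ f ω) {M : ℝ} (hM : 0 < M)
    (h2 : ∫⁻ ω, ENNReal.ofReal (f ω) ∂(P.withDensity fun ω => ENNReal.ofReal (f ω)) ≤
      ENNReal.ofReal M) {A : Set Ω} (hA : MeasurableSet A)
    (hPA : ENNReal.ofReal (1 / 2) ≤ (P.withDensity fun ω => ENNReal.ofReal (f ω)) A) :
    ENNReal.ofReal (1 / (16 * M)) ≤ P A := by
  have hfm : Measurable fun ω => ENNReal.ofReal (f ω) := by fun_prop
  rw [withDensity_apply _ hA] at hPA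
  rw [lintegral_withDensity_eq_lintegral_mul _ hfm hfm] at h2
  -- Truncation at height 4M: integrating f ≤ 4M + f²/(4M) over A leaves 4M·P(A) + 1/4.
  have hpt : ∀ ω, ENNReal.ofReal (f ω) ≤ ENNReal.ofReal (4 * M) + ENNReal.ofReal (1 / (4 * M)) *
      ((fun ω => ENNReal.ofReal (f ω)) * fun ω => ENNReal.ofReal (f ω)) ω := by
    intro ω
    rw [Pi.mul_apply, ← ENNReal.ofReal_mul (hf0 ω), ← ENNReal.ofReal_mul (by positivity),
      ← ENNReal.ofReal_add (by positivity) (mul_nonneg (by positivity) (mul_self_nonneg _))]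
    refine ENNReal.ofReal_le_ofReal ?_
    have : f ω = 4 * M * (f ω / (4 * M)) := by field_simp
    have h3 : 1 / (4 * M) * (f ω * f ω) = 4 * M * (f ω / (4 * M)) ^ 2 := by field_simp
    rw [h3]
    nlinarith [sq_nonneg (f ω / (4 * M) - 1), mul_nonneg hM.le (sq_nonneg (f ω / (4 * M) - 1)),
      mul_nonneg hM.le (sq_nonneg (f ω / (4 * M)))]
  have h4 : ENNReal.ofReal (1 / 2) ≤ ENNReal.ofReal (4 * M) * P A + ENNReal.ofReal (1 / 4) := by
    refine hPA.trans ((lintegral_mono hpt).trans ?_)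
    rw [lintegral_add_left measurable_const, lintegral_const, Measure.restrict_apply_univ]
    gcongr
    rw [lintegral_const_mul _ (hfm.mul hfm)]
    calc _ ≤ ENNReal.ofReal (1 / (4 * M)) * ENNReal.ofReal M := by
          gcongr
          exact (setLIntegral_le_lintegral _ _).trans h2
      _ = _ := by
          rw [← ENNReal.ofReal_mul (by positivity)]
          congr 1
          field_simp
  by_cases htop : P A = ⊤
  · simp [htop]
  rw [← ENNReal.ofReal_toReal htop, ← ENNReal.ofReal_mul (by positivity),
    ← ENNReal.ofReal_add (by positivity) (by norm_num),
    ENNReal.ofReal_le_ofReal_iff (by positivity)] at h4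
  rw [← ENNReal.ofReal_toReal htop]
  refine ENNReal.ofReal_le_ofReal ?_
  rw [div_le_iff₀ (by positivity)]
  linarith

/-- With γ = d/96 the cubic term is at most half of γsΛ. The remainder is of order K³, against K²
for the quadratic term, so a large K wins. -/
lemma upper_exponent_le {c d γ K X S s m n Λ : ℝ} (hc : 0 < c) (hd : 0 < d) (hd1 : d ≤ 1)
    (hγ : γ = d / 96) (hK : 24 * γ / c + 192 * c / γ ≤ K) (hK1 : 1 ≤ K) (hs : 0 < s)
    (hX : X * s ^ 3 = K ^ 3) (hS : S * s ^ 2 = K ^ 2) (hΛ : s * Λ = K ^ 3 / (12 * c))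
    (hκ : n / d ^ 2 - m / c ^ 2 ≤ 2 * S / c ^ 2) (hB : m / c ^ 3 + n / d ^ 3 ≤ 2 * X / (c * d)) :
    (n / d ^ 2 - m / c ^ 2) * (γ * s) ^ 2 / 2 + 2 * (m / c ^ 3 + n / d ^ 3) * (γ * s) ^ 3 -
      γ * s * Λ ≤ -8 := by
  have hγ0 : 0 < γ := by rw [hγ]; positivity
  have h1 : (n / d ^ 2 - m / c ^ 2) * (γ * s) ^ 2 / 2 ≤ γ ^ 2 * K ^ 2 / c ^ 2 := by
    calc _ ≤ 2 * S / c ^ 2 * (γ * s) ^ 2 / 2 := by gcongr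
      _ = γ ^ 2 * (S * s ^ 2) / c ^ 2 := by ring
      _ = _ := by rw [hS]
  have h2 : 2 * (m / c ^ 3 + n / d ^ 3) * (γ * s) ^ 3 ≤ γ * K ^ 3 / (24 * c) := by
    calc _ ≤ 2 * (2 * X / (c * d)) * (γ * s) ^ 3 := by gcongr
      _ = 4 * γ ^ 3 * (X * s ^ 3) / (c * d) := by ring
      _ = γ * K ^ 3 / (24 * c) * γ := by rw [hX, hγ]; field_simp; norm_num
      _ ≤ γ * K ^ 3 / (24 * c) * 1 := by
        gcongr
        rw [hγ]
        linarith
      _ = _ := mul_one _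
  have h3 : γ * s * Λ = 2 * (γ * K ^ 3 / (24 * c)) := by
    rw [mul_assoc, hΛ]; field_simp; norm_num
  have h4 : γ ^ 2 / c ^ 2 + 8 ≤ γ * K / (24 * c) := by
    rw [le_div_iff₀ (by positivity)]
    calc _ = γ * (24 * γ / c + 192 * c / γ) := by field_simp; ring
      _ ≤ _ := by gcongr
  have h5 : γ ^ 2 * K ^ 2 / c ^ 2 + 8 ≤ γ * K ^ 3 / (24 * c) := by
    have hK2 : 1 ≤ K ^ 2 := one_le_pow₀ hK1
    calc _ ≤ K ^ 2 * (γ ^ 2 / c ^ 2 + 8) := by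
          have : K ^ 2 * (γ ^ 2 / c ^ 2) = γ ^ 2 * K ^ 2 / c ^ 2 := by ring
          rw [mul_add, this]
          linarith
      _ ≤ K ^ 2 * (γ * K / (24 * c)) := by gcongr
      _ = _ := by ring
  linarith

/-- The cubic gain is at least twice sΛ, so a term -K³/(12c) survives and dominates the quadratic
K²/c² for large K. -/
lemma lower_exponent_le {c d K X S s m n Λ : ℝ} (hc : 0 < c)
    (hK : 12 / c + 96 * c ≤ K) (hK1 : 1 ≤ K) (hs : 0 < s)
    (hX : X * s ^ 3 = K ^ 3) (hS : S * s ^ 2 = K ^ 2) (hΛ : s * Λ = K ^ 3 / (12 * c))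
    (hκ : n / d ^ 2 - m / c ^ 2 ≤ 2 * S / c ^ 2) (hm : X * c ^ 2 / 2 ≤ m) :
    (n / d ^ 2 - m / c ^ 2) * s ^ 2 / 2 - m * (s / c) ^ 3 / 3 + s * Λ ≤ -8 := by
  have h1 : (n / d ^ 2 - m / c ^ 2) * s ^ 2 / 2 ≤ K ^ 2 / c ^ 2 := by
    calc _ ≤ 2 * S / c ^ 2 * s ^ 2 / 2 := by gcongr
      _ = (S * s ^ 2) / c ^ 2 := by ring
      _ = _ := by rw [hS]
  have h2 : 2 * (K ^ 3 / (12 * c)) ≤ m * (s / c) ^ 3 / 3 := by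
    calc _ = X * s ^ 3 / (6 * c) := by rw [hX]; field_simp; norm_num
      _ = X * c ^ 2 / 2 * (s / c) ^ 3 / 3 := by field_simp; ring
      _ ≤ _ := by gcongr
  have h4 : 1 / c ^ 2 + 8 ≤ K / (12 * c) := by
    rw [le_div_iff₀ (by positivity)]
    calc _ = 12 / c + 96 * c := by field_simp; ring
      _ ≤ _ := hK
  have h5 : K ^ 2 / c ^ 2 + 8 ≤ K ^ 3 / (12 * c) := by
    have hK2 : 1 ≤ K ^ 2 := one_le_pow₀ hK1
    calc _ ≤ K ^ 2 * (1 / c ^ 2 + 8) := by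
          have : K ^ 2 * (1 / c ^ 2) = K ^ 2 / c ^ 2 := by ring
          rw [mul_add, this]
          linarith
      _ ≤ K ^ 2 * (K / (12 * c)) := by gcongr
      _ = _ := by ring
  rw [hΛ]
  linarith

/-- Deviation of the endpoint from the characteristic direction of the tilted parameter. -/
lemma tilted_deviation_le {c d K T X S s m n : ℝ} (hc : 0 < c) (hd : 0 < d) (hcd : d = 1 - c)
    (hs : 0 < s) (hsc : s ≤ c / 4) (hXs : X * s = K * S) (hS : 1 / d ^ 2 ≤ S)
    (hn : X * d ^ 2 - 1 ≤ n) (hm : m ≤ X * c ^ 2 - (2 * K / d + 1 + T) * S) (hX : 0 ≤ X) :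
    T * S ≤ n / (d + s) ^ 2 * (c - s) ^ 2 - m + 1 := by
  have hds : 0 < d + s := by positivity
  have hcs : 0 < c - s := by linarith
  -- Linearization of the squared slope in s, using c + d = 1. Multiplied by Xd² the change is
  -- 2Xsc/d ≤ (2K/d)S, which explains that term in the length l; one more S absorbs rounding and T·S
  -- is left over.
  have hratio : c ^ 2 / d ^ 2 - 2 * s * c / d ^ 3 ≤ (c - s) ^ 2 / (d + s) ^ 2 := by
    rw [le_div_iff₀ (by positivity)]
    have h1 : (c ^ 2 / d ^ 2 - 2 * s * c / d ^ 3) * (d + s) ^ 2 =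
        (c - s) ^ 2 - (s ^ 2 * (d ^ 3 + 4 * c * d + 2 * s * c - c ^ 2 * d) / d ^ 3 +
          2 * s * c * (1 - (c + d)) / d) := by
      field_simp
      ring
    rw [h1, show 1 - (c + d) = 0 by rw [hcd]; ring]
    have : 0 ≤ s ^ 2 * (d ^ 3 + 4 * c * d + 2 * s * c - c ^ 2 * d) / d ^ 3 := by
      have h2 : 0 ≤ 4 * c * d - c ^ 2 * d := by
        have : 0 ≤ c * d * (4 - c) := mul_nonneg (by positivity) (by linarith)
        linarith
      have h3 : 0 ≤ d ^ 3 + 4 * c * d + 2 * s * c - c ^ 2 * d := by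
        have : 0 ≤ d ^ 3 + 2 * s * c := by positivity
        linarith
      positivity
    simp only [mul_zero, zero_div, add_zero]
    linarith
  have hratio1 : (c - s) ^ 2 / (d + s) ^ 2 ≤ c ^ 2 / d ^ 2 := by
    gcongr <;> linarith
  have h1 : X * c ^ 2 - 2 * K / d * S - S ≤ n / (d + s) ^ 2 * (c - s) ^ 2 := by
    have e1 : n / (d + s) ^ 2 * (c - s) ^ 2 = n * ((c - s) ^ 2 / (d + s) ^ 2) := by ring
    rw [e1]
    have h2 : (X * d ^ 2 - 1) * ((c - s) ^ 2 / (d + s) ^ 2) ≤ n * ((c - s) ^ 2 / (d + s) ^ 2) := by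
      gcongr
    have h3 : X * d ^ 2 * (c ^ 2 / d ^ 2 - 2 * s * c / d ^ 3) ≤
        X * d ^ 2 * ((c - s) ^ 2 / (d + s) ^ 2) := by gcongr
    have h4 : X * d ^ 2 * (c ^ 2 / d ^ 2 - 2 * s * c / d ^ 3) =
        X * c ^ 2 - 2 * (X * s) / d * c := by field_simp
    have h5 : 2 * K / d * S * c ≤ 2 * K / d * S := by
      have : 0 ≤ K * S := by rw [← hXs]; positivity
      have h6 : 0 ≤ 2 * K / d * S := by
        have : 2 * K / d * S = 2 * (K * S) / d := by ring
        rw [this]; positivity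
      exact mul_le_of_le_one_right h6 (by linarith)
    have h7 : c ^ 2 / d ^ 2 ≤ 1 / d ^ 2 := by
      gcongr
      exact pow_le_one₀ hc.le (by linarith)
    have h8 : 2 * (K * S) / d * c = 2 * K / d * S * c := by ring
    rw [h4, hXs, h8] at h3
    linarith
  linarith

/-! ### Horizontal exit under the tilted measure -/

section

variable {Ω : Type*} [MeasurableSpace Ω] {P : Measure Ω} {w : ℕ × ℕ → Ω → ℝ}

lemma half_le_measure_of_compl_subset [IsProbabilityMeasure P] {A E₁ E₂ E₃ : Set Ω}
    (hA : MeasurableSet A) (hsub : ∀ᵐ ω ∂P, ω ∉ A → ω ∈ E₁ ∨ ω ∈ E₂ ∨ ω ∈ E₃)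
    {p₁ p₂ p₃ : ℝ} (h₁ : P E₁ ≤ ENNReal.ofReal p₁) (h₂ : P E₂ ≤ ENNReal.ofReal p₂)
    (h₃ : P E₃ ≤ ENNReal.ofReal p₃) (hp₁ : p₁ ≤ 1 / 8) (hp₂ : p₂ ≤ 1 / 8) (hp₃ : p₃ ≤ 1 / 4) :
    ENNReal.ofReal (1 / 2) ≤ P A := by
  have hsub' : Aᶜ ≤ᵐ[P] (E₁ ∪ (E₂ ∪ E₃) : Set Ω) := hsub
  have h1 : P Aᶜ ≤ ENNReal.ofReal (1 / 2) := by
    refine (measure_mono_ae hsub').trans ((measure_union_le _ _).trans ?_)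
    refine (add_le_add (h₁.trans (ENNReal.ofReal_le_ofReal hp₁)) ((measure_union_le _ _).trans
      (add_le_add (h₂.trans (ENNReal.ofReal_le_ofReal hp₂))
        (h₃.trans (ENNReal.ofReal_le_ofReal hp₃))))).trans ?_
    rw [← ENNReal.ofReal_add (by norm_num) (by norm_num),
      ← ENNReal.ofReal_add (by norm_num) (by norm_num)]
    exact ENNReal.ofReal_le_ofReal (by norm_num)
  have h2 := ENNReal.toReal_le_of_le_ofReal (by norm_num) h1
  change P.real Aᶜ ≤ 1 / 2 at h2
  rw [measureReal_compl hA, probReal_univ] at h2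
  refine ENNReal.ofReal_le_of_le_toReal ?_
  change 1 / 2 ≤ P.real A
  linarith

lemma curvature_le {c d X S m n : ℝ} (hc : 0 < c) (hc1 : c ≤ 1) (hd : 0 < d)
    (hS : 1 / d ^ 2 + 1 ≤ S) (hm : X * c ^ 2 - S - 1 ≤ m) (hn : n ≤ X * d ^ 2 + 1) :
    n / d ^ 2 - m / c ^ 2 ≤ 2 * S / c ^ 2 := by
  have h0 : 0 < 1 / d ^ 2 := by positivity
  have h1 : n / d ^ 2 ≤ X + 1 / d ^ 2 := by
    rw [div_le_iff₀ (by positivity), add_mul, one_div_mul_cancel (by positivity)]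
    exact hn
  have h2 : X - (S + 1) / c ^ 2 ≤ m / c ^ 2 := by
    rw [le_div_iff₀ (by positivity), sub_mul, div_mul_cancel₀ _ (by positivity)]
    linarith
  have h3 : 2 * S / c ^ 2 = (S + 1) / c ^ 2 + (S - 1) / c ^ 2 := by ring
  have h4 : S - 1 ≤ (S - 1) / c ^ 2 := by
    rw [le_div_iff₀ (by positivity)]
    exact mul_le_of_le_one_right (by linarith) (pow_le_one₀ hc.le hc1)
  linarith

lemma third_moment_le {c d X m n : ℝ} (hc : 0 < c) (hd : 0 < d) (hcd : d = 1 - c) (hX : 0 < X)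
    (hm : m ≤ X * c ^ 2) (hn : n ≤ 2 * X * d ^ 2) :
    m / c ^ 3 + n / d ^ 3 ≤ 2 * X / (c * d) := by
  have h1 : m / c ^ 3 ≤ X / c := by
    rw [div_le_div_iff₀ (by positivity) hc]
    calc _ ≤ X * c ^ 2 * c := by gcongr
      _ = _ := by ring
  have h2 : n / d ^ 3 ≤ 2 * X / d := by
    rw [div_le_div_iff₀ (by positivity) hd]
    calc _ ≤ 2 * X * d ^ 2 * d := by gcongr
      _ = _ := by ring
  have h3 : 2 * X / c + 2 * X / d = 2 * X / (c * d) := by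
    rw [div_add_div _ _ hc.ne' hd.ne', hcd]
    congr 1
    ring
  have h4 : X / c ≤ 2 * X / c := by gcongr; linarith
  linarith

/-- The scalings force S³ = X², so S'³/X'² is bounded below by T/4, and T is chosen to outweigh the
constant of the cubic exit bound. -/
lemma deviation_exponent_le {c d s T S X S' X' K : ℝ} (hc : 0 < c) (hd : 0 < d) (hs : 0 < s)
    (hsc : 2 * s ≤ c) (hT : T = 2 ^ 24 / (c * d) ^ 2) (hT1 : 1 ≤ T)
    (hX : X * s ^ 3 = K ^ 3) (hS : S * s ^ 2 = K ^ 2) (hX'0 : 0 < X') (hX' : X' ≤ 2 * X)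
    (hS0 : 0 < S) (hS' : T * S ≤ S') :
    8 ≤ ((c - s) * (d + s)) ^ 2 / 131072 * (S' ^ 3 / X' ^ 2) := by
  have h1 : (c * d) ^ 2 / 2 ^ 19 ≤ ((c - s) * (d + s)) ^ 2 / 131072 := by
    have h2 : (c / 2 * d) ^ 2 ≤ ((c - s) * (d + s)) ^ 2 := by
      gcongr <;> linarith
    calc _ = (c / 2 * d) ^ 2 / 131072 := by ring
      _ ≤ _ := by gcongr
  have hS3 : S ^ 3 = X ^ 2 := by
    have hs6 : s ^ 6 ≠ 0 := by positivity
    have : S ^ 3 * s ^ 6 = X ^ 2 * s ^ 6 := by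
      calc _ = (S * s ^ 2) ^ 3 := by ring
        _ = (X * s ^ 3) ^ 2 := by rw [hS, hX]; ring
        _ = _ := by ring
    exact mul_right_cancel₀ hs6 this
  have h3 : T / 4 ≤ S' ^ 3 / X' ^ 2 := by
    rw [le_div_iff₀ (by positivity)]
    calc T / 4 * X' ^ 2 ≤ T / 4 * (2 * X) ^ 2 := by gcongr
      _ = T * S ^ 3 := by rw [hS3]; ring
      _ ≤ T ^ 3 * S ^ 3 := by
        gcongr
        exact le_self_pow₀ hT1 (by norm_num)
      _ = (T * S) ^ 3 := by ring
      _ ≤ S' ^ 3 := by gcongr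
  calc (8 : ℝ) = (c * d) ^ 2 / 2 ^ 19 * (T / 4) := by rw [hT]; field_simp; norm_num
    _ ≤ _ := by gcongr

set_option maxHeartbeats 400000 in
/-- With horizontal rates decreased on a long enough part of the axis, horizontal exit has
probability at least one half. -/
lemma IsExpFamily.half_le_measure_verPassage_lt {c d K T γ S X s : ℝ} {l m n : ℕ}
    (h : IsExpFamily P (fun x => if 0 < x.1 ∧ x.1 ≤ l ∧ x.2 = 0 then c - s
      else boundaryRate c d x) w)
    (hc : 0 < c) (hd : 0 < d) (hcd : d = 1 - c) (hγ : γ = d / 96)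
    (hT : T = 2 ^ 24 / (c * d) ^ 2) (hK1 : 1 ≤ K)
    (hK2 : 24 * γ / c + 192 * c / γ ≤ K) (hK3 : 12 / c + 96 * c ≤ K) (hs : 0 < s)
    (hX : X * s ^ 3 = K ^ 3) (hS : S * s ^ 2 = K ^ 2) (hXs : X * s = K * S)
    (hs1 : 4 * s ≤ c * d) (hS1 : 16 / (c * d) ^ 2 ≤ S) (hSX : 4 * S ≤ X * c ^ 2)
    (hl : (2 * K / d + 1 + T) * S ≤ l)
    (hm1 : X * c ^ 2 - S - 1 ≤ ((l + m + 1 : ℕ) : ℝ))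
    (hm2 : ((l + m + 1 : ℕ) : ℝ) ≤ X * c ^ 2 - S + 1)
    (hn1 : X * d ^ 2 - 1 ≤ ((n + 1 : ℕ) : ℝ)) (hn2 : ((n + 1 : ℕ) : ℝ) ≤ X * d ^ 2 + 1) :
    ENNReal.ofReal (1 / 2) ≤ P {ω | verPassage (fun x => w x ω) (l + m + 1) n <
      horPassage (fun x => w x ω) (l + m) (n + 1)} := by
  have hP := h.isProbabilityMeasure
  have hc1 : c < 1 := by linarith
  have hd1 : d < 1 := by linarith
  have hcd1 : c * d ≤ c := mul_le_of_le_one_right hc.le hd1.le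
  have hcd2 : c * d ≤ d := mul_le_of_le_one_left hd.le hc1.le
  have hcs : 0 < c - s := by linarith
  have hγ0 : 0 < γ := by rw [hγ]; positivity
  have hγ1 : γ ≤ 1 := by rw [hγ]; linarith
  have hγs : γ * s ≤ s := mul_le_of_le_one_left hs.le hγ1
  have hγs0 : 0 < γ * s := by positivity
  have hinvd : 1 / d ^ 2 ≤ 1 / (c * d) ^ 2 := by gcongr
  have hinvc : 1 / c ^ 2 ≤ 1 / (c * d) ^ 2 := by gcongr
  have hinv1 : 1 ≤ 1 / d ^ 2 := (one_le_div (by positivity)).2 (pow_le_one₀ hd.le hd1.le)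
  have hinv2 : 1 ≤ 1 / c ^ 2 := (one_le_div (by positivity)).2 (pow_le_one₀ hc.le hc1.le)
  have h16 : 16 / (c * d) ^ 2 = 16 * (1 / (c * d) ^ 2) := by ring
  have hS0 : 16 ≤ S := by linarith
  have hX0 : 0 < X := by
    by_contra! hcon
    have : X * c ^ 2 ≤ 0 := mul_nonpos_of_nonpos_of_nonneg hcon (by positivity)
    linarith
  have hXS : S ≤ X := by
    have : X * c ^ 2 ≤ X := mul_le_of_le_one_right hX0.le (pow_le_one₀ hc.le hc1.le)
    linarith
  have hXd : 1 ≤ X * d ^ 2 := by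
    have := mul_le_mul_of_nonneg_right (by linarith : 1 / d ^ 2 ≤ X) (sq_nonneg d)
    rwa [one_div_mul_cancel (by positivity)] at this
  set m' : ℝ := ((l + m + 1 : ℕ) : ℝ) with hm'
  set n' : ℝ := ((n + 1 : ℕ) : ℝ) with hn'
  have hκ : n' / d ^ 2 - m' / c ^ 2 ≤ 2 * S / c ^ 2 :=
    curvature_le hc hc1.le hd (by linarith) hm1 hn2
  have hB : m' / c ^ 3 + n' / d ^ 3 ≤ 2 * X / (c * d) :=
    third_moment_le hc hd hcd hX0 (by linarith) (by linarith)
  set Λ : ℝ := X * s ^ 2 / (12 * c) with hΛ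
  have hsΛ : s * Λ = K ^ 3 / (12 * c) := by
    rw [hΛ, ← hX]; ring
  -- Extends the lowered rate c-s to the whole horizontal axis, so that exact formulas for constant
  -- boundary rates apply.
  set q : ℕ × ℕ → ℝ := fun x => if l < x.1 ∧ x.2 = 0 then c / (c - s) else 1 with hq
  have hq0 : ∀ x, 0 < q x := by
    intro x
    simp only [hq]
    split_ifs <;> positivity
  have hr0 : ∀ x : ℕ × ℕ, 0 < if 0 < x.1 ∧ x.1 ≤ l ∧ x.2 = 0 then c - s
      else boundaryRate c d x := by
    intro x
    split_ifs
    exacts [hcs, boundaryRate_pos hc hd x]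
  have hW : IsExpFamily P (boundaryRate (c - s) d) (fun x ω => q x * w x ω) := by
    refine (h.scale hr0 hq0).congr (fun x hx => ?_) fun _ _ => rfl
    obtain ⟨i, j⟩ := x
    rcases j with _ | j
    · have hi : 0 < i := by
        rcases i with _ | i
        · exact absurd rfl hx
        · omega
      rcases Nat.lt_or_ge l i with hli | hli
      · simp [hq, hli, hli.not_ge, boundaryRate, hc.ne']
      · simp [hq, hli, hli.not_gt, hi, boundaryRate]
    · simp [hq, boundaryRate]
  have hE2 := (hcd ▸ hW).measure_lower_tail_le (c := c) hc1 hs (by linarith) (l + m + 1) (n + 1) Λ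
  rw [← hcd, ← hm', ← hn'] at hE2
  -- Horizontal rate c+γs leaves the vertical optimum unchanged, so an upper tail for this model
  -- bounds that optimum by L.
  have hW1 := hW.boundaryScale hcs hd (α := (c - s) / (c + γ * s)) (β := 1) (by positivity) one_pos
  rw [div_div_cancel₀ hcs.ne', div_one, hcd] at hW1
  have hE1 := hW1.measure_upper_tail_le (s := γ * s) hγs0 (by linarith) (by linarith)
    (l + m + 1) (n + 1) Λ
  rw [← hcd, ← hm', ← hn'] at hE1
  -- Raising the vertical rate to d+s = 1-(c-s) makes the model stationary with parameter c-s, so it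
  -- can be viewed from (l,0).
  have hW3 := hW.boundaryScale hcs hd (α := 1) (β := d / (d + s)) one_pos (by positivity)
  rw [div_div_cancel₀ hd.ne', div_one, show d + s = 1 - (c - s) by rw [hcd]; ring] at hW3
  have hshift := hW3.shiftWeights hcs (by linarith) (by ring) (l, 0)
  have hds : 1 - (c - s) = d + s := by rw [hcd]; ring
  -- X' and S' are the scale and the displacement of the endpoint seen from (l,0), relative to the
  -- c-s characteristic; they are defined so that the coordinate conditions below are equalities.
  set X' : ℝ := n' / (d + s) ^ 2 with hX'
  set S' : ℝ := X' * (c - s) ^ 2 - (m + 1) + 1 with hS'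
  have hdev : T * S ≤ S' := by
    refine tilted_deviation_le hc hd hcd hs (by linarith) hXs (by linarith) hn1 ?_ hX0.le
    have : m' = l + m + 1 := by rw [hm']; push_cast; ring
    linarith
  have hT1 : 2 ^ 24 ≤ T := by
    rw [hT, le_div_iff₀ (by positivity)]
    have : (c * d) ^ 2 ≤ 1 := pow_le_one₀ (by positivity) (hcd1.trans hc1.le)
    linarith
  have hX'0 : 0 < X' := by
    have : 0 < n' := by rw [hn']; positivity
    positivity
  have hX'X : X' ≤ 2 * X := by
    rw [hX', div_le_iff₀ (by positivity)]
    calc n' ≤ 2 * X * d ^ 2 := by linarith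
      _ ≤ _ := by gcongr; linarith
  have hTS : S ≤ T * S := le_mul_of_one_le_left (by linarith only [hS0]) (by linarith only [hT1])
  have hE3 := hshift.measure_horizontal_exit_le (X := X') (S := S') hcs (by linarith) m n
    (by
      rw [hS']
      have h1 : X' * (c - s) ^ 2 ≤ X' :=
        mul_le_of_le_one_right hX'0.le (pow_le_one₀ hcs.le (by linarith))
      have h2 : (0 : ℝ) ≤ m := by positivity
      linarith)
    (by
      rw [hds]
      have h1 : 1 / (d + s) ^ 2 ≤ 1 / d ^ 2 := by gcongr; linarith
      have h2 : 1 / (c - s) ^ 2 ≤ 4 * (1 / c ^ 2) := by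
        have : 4 * (1 / c ^ 2) = 1 / (c / 2) ^ 2 := by field_simp; norm_num
        rw [this]
        gcongr
        linarith
      have h3 : 2 / (d + s) ^ 2 = 2 * (1 / (d + s) ^ 2) := by ring
      rw [h3]
      linarith)
    (by rw [hS']; linarith)
    (by
      rw [hds, hX', div_mul_cancel₀ _ (by positivity), hn']
      push_cast
      exact le_rfl)
    (by
      rw [hds, hX', div_mul_cancel₀ _ (by positivity), hn']
      push_cast
      linarith)
  rw [hds] at hE3
  have hexp8 : Real.exp (-8) ≤ 1 / 8 := exp_neg_le_inv (by norm_num)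
  have b1 : Real.exp ((n' / d ^ 2 - m' / c ^ 2) * (γ * s) ^ 2 / 2 +
      2 * (m' / c ^ 3 + n' / d ^ 3) * (γ * s) ^ 3 - γ * s * Λ) ≤ 1 / 8 :=
    (Real.exp_le_exp.2 (upper_exponent_le hc hd hd1.le hγ hK2 hK1 hs hX hS hsΛ hκ hB)).trans hexp8
  have b2 : Real.exp ((n' / d ^ 2 - m' / c ^ 2) * s ^ 2 / 2 - m' * (s / c) ^ 3 / 3 + s * Λ) ≤
      1 / 8 :=
    (Real.exp_le_exp.2 (lower_exponent_le hc hK3 hK1 hs hX hS hsΛ hκ (by linarith))).trans hexp8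
  have b3 : Real.exp (-(((c - s) * (d + s)) ^ 2 / 131072 * (S' ^ 3 / X' ^ 2))) ≤ 1 / 8 :=
    (Real.exp_le_exp.2 (neg_le_neg (deviation_exponent_le hc hd hs (by linarith) hT
      (by linarith) hX hS hX'0 hX'X (by linarith) hdev))).trans hexp8
  set L : ℝ := m' / c + n' / d + Λ with hL
  have hmeas : MeasurableSet {ω | verPassage (fun x => w x ω) (l + m + 1) n <
      horPassage (fun x => w x ω) (l + m) (n + 1)} :=
    measurableSet_lt (measurable_verPassage h.measurable_of_ne _ _)
      (measurable_horPassage h.measurable_of_ne _ _)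
  refine half_le_measure_of_compl_subset hmeas ?_ hE1 hE2 hE3 b1 b2 (by linarith)
  filter_upwards [hW.nonneg] with ω hω hle
  by_contra hcon
  obtain ⟨hn1, hcon⟩ := not_or.1 hcon
  obtain ⟨hn2, hn3⟩ := not_or.1 hcon
  refine hle (verPassage_lt_horPassage_of (W := fun x => q x * w x ω) hω
    (fun x _ hx => ?_) (β := d / (d + s)) ?_ (lt_of_not_ge hn1) (lt_of_not_ge hn2)
    (lt_of_not_ge hn3))
  · have : ¬ (l < x.1 ∧ x.2 = 0) := by
      rintro ⟨h1, h2⟩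
      rcases hx with hx | hx
      · exact hx h2
      · omega
    simp [hq, this]
  · rw [div_le_one (by positivity)]
    linarith

end

set_option maxHeartbeats 600000 in
/-- Horizontal exit has probability bounded below when the endpoint is within the fluctuation
scale `S = X ^ (2/3)` of the characteristic direction. -/
lemma exists_le_measure_verPassage_lt {c : ℝ} (hc : 0 < c) (hc' : c < 1) :
    ∃ ε η₀ : ℝ, 0 < ε ∧ 0 < η₀ ∧ ∀ η : ℝ, 0 < η → η ≤ η₀ → ∀ m n : ℕ,
      1 / η ^ 3 * c ^ 2 - 1 / η ^ 2 - 1 ≤ ((m + 1 : ℕ) : ℝ) →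
      ((m + 1 : ℕ) : ℝ) ≤ 1 / η ^ 3 * c ^ 2 - 1 / η ^ 2 + 1 →
      1 / η ^ 3 * (1 - c) ^ 2 - 1 ≤ ((n + 1 : ℕ) : ℝ) →
      ((n + 1 : ℕ) : ℝ) ≤ 1 / η ^ 3 * (1 - c) ^ 2 + 1 →
      ∀ (Ω : Type*) [MeasurableSpace Ω] (P : Measure Ω) (w : ℕ × ℕ → Ω → ℝ),
        IsExpFamily P (boundaryRate c (1 - c)) w →
        ENNReal.ofReal ε ≤ P {ω | verPassage (fun x => w x ω) (m + 1) n <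
          horPassage (fun x => w x ω) m (n + 1)} := by
  have hd : 0 < 1 - c := by linarith
  obtain ⟨d, hcd⟩ : ∃ d, d = 1 - c := ⟨_, rfl⟩
  rw [← hcd] at hd ⊢
  obtain ⟨γ, hγ⟩ : ∃ γ, γ = d / 96 := ⟨_, rfl⟩
  have hγ0 : 0 < γ := by rw [hγ]; positivity
  obtain ⟨T, hT⟩ : ∃ T, T = 2 ^ 24 / (c * d) ^ 2 := ⟨_, rfl⟩
  have hT0 : 0 < T := by rw [hT]; positivity
  obtain ⟨K, hK⟩ : ∃ K, K = 1 + (12 / c + 96 * c) + (24 * γ / c + 192 * c / γ) := ⟨_, rfl⟩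
  have hk1 : 0 < 12 / c + 96 * c := by positivity
  have hk2 : 0 < 24 * γ / c + 192 * c / γ := by positivity
  have hK1 : 1 ≤ K := by linarith
  have hK0 : 0 < K := by linarith
  obtain ⟨K₂, hK₂⟩ : ∃ K₂, K₂ = 2 * K / d + 1 + T := ⟨_, rfl⟩
  have hK₂1 : 1 ≤ K₂ := by
    have : 0 < 2 * K / d := by positivity
    linarith
  -- M bounds the second moment of the density: each tilted site contributes a factor at most
  -- exp(2s²/c²), there are l ≤ 2K₂S sites, and Ss² = K².
  obtain ⟨M, hM⟩ : ∃ M, M = Real.exp (4 * K₂ * K ^ 2 / c ^ 2) := ⟨_, rfl⟩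
  have hM0 : 0 < M := by rw [hM]; positivity
  -- The first bound on η gives 4s ≤ cd; the second gives (K₂+4)S ≤ Xc², so that the l modified
  -- sites fit into the m available ones.
  refine ⟨1 / (16 * M), min (c * d / (4 * K)) (c ^ 2 / (K₂ + 4)), by positivity, by positivity, ?_⟩
  intro η hη hη₀ m n hm1 hm2 hn1 hn2 Ω _ P w h
  obtain ⟨hη1, hη2⟩ := le_min_iff.1 hη₀
  rw [le_div_iff₀ (by positivity)] at hη1 hη2
  obtain ⟨S, hS⟩ : ∃ S, S = 1 / η ^ 2 := ⟨_, rfl⟩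
  obtain ⟨X, hX⟩ : ∃ X, X = 1 / η ^ 3 := ⟨_, rfl⟩
  rw [← hS, ← hX] at hm1 hm2
  rw [← hX] at hn1 hn2
  obtain ⟨s, hs⟩ : ∃ s, s = K * η := ⟨_, rfl⟩
  have hs0 : 0 < s := by rw [hs]; positivity
  have hXs3 : X * s ^ 3 = K ^ 3 := by rw [hX, hs]; field_simp
  have hSs2 : S * s ^ 2 = K ^ 2 := by rw [hS, hs]; field_simp
  have hXs : X * s = K * S := by rw [hX, hS, hs]; field_simp
  have hs1 : 4 * s ≤ c * d := by rw [hs]; linarith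
  have hS0 : 0 < S := by rw [hS]; positivity
  have hX0 : 0 < X := by rw [hX]; positivity
  have hS1 : 16 / (c * d) ^ 2 ≤ S := by
    rw [hS, div_le_div_iff₀ (by positivity) (by positivity), one_mul]
    have : 4 * η ≤ c * d := by nlinarith
    calc 16 * η ^ 2 = (4 * η) ^ 2 := by ring
      _ ≤ _ := by gcongr
  have hcd1 : c * d ≤ c := mul_le_of_le_one_right hc.le (by linarith)
  have hS16 : 1 ≤ S := by
    refine le_trans ?_ hS1
    rw [one_le_div (by positivity)]
    have : (c * d) ^ 2 ≤ 1 := pow_le_one₀ (by positivity) (by linarith)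
    linarith
  have hSXK : (K₂ + 4) * S ≤ X * c ^ 2 := by
    calc (K₂ + 4) * S = X * (η * (K₂ + 4)) := by rw [hX, hS]; field_simp
      _ ≤ _ := by gcongr
  have hSX : 4 * S ≤ X * c ^ 2 := by
    refine le_trans ?_ hSXK
    gcongr
    linarith
  obtain ⟨l, hl⟩ : ∃ l, l = ⌈K₂ * S⌉₊ := ⟨_, rfl⟩
  have hl1 : K₂ * S ≤ l := by rw [hl]; exact Nat.le_ceil _
  have hl2 : (l : ℝ) < K₂ * S + 1 := by rw [hl]; exact Nat.ceil_lt_add_one (by positivity)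
  have hlm : l ≤ m := by
    have : (l : ℝ) < m + 1 := by
      push_cast at hm1
      linarith
    have : l < m + 1 := by exact_mod_cast this
    omega
  obtain ⟨m', rfl⟩ := Nat.exists_eq_add_of_le hlm
  have hcs : 0 < c - s := by linarith
  have hcs2 : 0 < c - 2 * s := by linarith
  have hQ := h.tilt_hor (boundaryRate_pos hc hd) l hc hcs (fun i _ => by simp [boundaryRate])
  have hm := h.measurable_of_ne
  have hlp := measurable_lastPassage hm l 0
  -- The second moment of the density is its mean under the tilted measure. It is R times the total
  -- mass of a further tilt from c-s to c-2s, so it equals R.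
  have hQ2 := hQ.tilt_hor (b := c - 2 * s) (fun x => by
    split_ifs
    exacts [hcs, boundaryRate_pos hc hd x]) l hcs hcs2
    (fun i hi => if_pos ⟨Nat.succ_pos i, hi, rfl⟩)
  refine le_measure_of_withDensity (M := M)
    (f := fun ω => ((c - s) / c) ^ l * Real.exp ((c - (c - s)) * lastPassage (fun x => w x ω) l 0))
    (by fun_prop) (fun ω => by positivity) hM0 ?_ ?_ ?_
  · have h1 := hQ2.isProbabilityMeasure.measure_univ
    rw [withDensity_apply _ .univ, Measure.restrict_univ] at h1
    obtain ⟨R, hR⟩ : ∃ R, R = ((c - s) ^ 2 / (c * (c - 2 * s))) ^ l := ⟨_, rfl⟩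
    have hR0 : 0 ≤ R := by rw [hR]; positivity
    have key : ∀ u v : ℝ, u ≠ 0 → v ≠ 0 → u / c = u ^ 2 / (c * v) * (v / u) := by
      intro u v hu hv
      field_simp
    have h2 : ∀ ω, ENNReal.ofReal (((c - s) / c) ^ l *
        Real.exp ((c - (c - s)) * lastPassage (fun x => w x ω) l 0)) = ENNReal.ofReal R *
        ENNReal.ofReal (((c - 2 * s) / (c - s)) ^ l *
          Real.exp ((c - s - (c - 2 * s)) * lastPassage (fun x => w x ω) l 0)) := by
      intro ω
      rw [← ENNReal.ofReal_mul hR0, hR, ← mul_assoc, ← mul_pow]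
      congr 3
      · exact key _ _ hcs.ne' hcs2.ne'
      · ring
    rw [lintegral_congr h2, lintegral_const_mul _ (by fun_prop), h1, mul_one]
    refine ENNReal.ofReal_le_ofReal ?_
    have h3 : (c - s) ^ 2 / (c * (c - 2 * s)) ≤ Real.exp (2 * s ^ 2 / c ^ 2) := by
      refine le_trans ?_ (Real.add_one_le_exp _)
      rw [div_le_iff₀ (by positivity)]
      have h4 : (2 * s ^ 2 / c ^ 2 + 1) * (c * (c - 2 * s)) =
          (c - s) ^ 2 + s ^ 2 * (c - 4 * s) / c := by field_simp; ring
      have h5 : 0 ≤ s ^ 2 * (c - 4 * s) / c := by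
        have : 0 ≤ c - 4 * s := by linarith
        positivity
      linarith
    calc R ≤ Real.exp (2 * s ^ 2 / c ^ 2) ^ l := by
          rw [hR]
          gcongr
      _ = Real.exp (2 * (l * s ^ 2) / c ^ 2) := by
          rw [← Real.exp_nat_mul]
          congr 1
          ring
      _ ≤ M := by
          rw [hM, Real.exp_le_exp]
          refine div_le_div_of_nonneg_right ?_ (by positivity)
          have h6 : (l : ℝ) ≤ 2 * K₂ * S := by
            have := one_le_mul_of_one_le_of_one_le hK₂1 hS16
            linarith
          calc 2 * (l * s ^ 2) ≤ 2 * (2 * K₂ * S * s ^ 2) := by gcongr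
            _ = 4 * K₂ * (S * s ^ 2) := by ring
            _ = _ := by rw [hSs2]
  · exact measurableSet_lt (measurable_verPassage hm _ _) (measurable_horPassage hm _ _)
  · exact hQ.half_le_measure_verPassage_lt hc hd hcd hγ hT hK1 (by linarith) (by linarith) hs0 hXs3
      hSs2 hXs hs1 hS1 hSX (hK₂ ▸ hl1) hm1 hm2 hn1 hn2

/-! ### From strict horizontal exit to missing the square -/

/-- If horizontal exit is strictly better from a corner to the lower right of the square, then
every geodesic misses the square. -/
lemma misses_of_verPassage_lt {w : ℕ × ℕ → ℝ} {t S : ℝ} {v : ℕ × ℕ} {m n : ℕ}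
    (hv1 : t * ((v.1 + (m + 1) : ℕ) : ℝ) + S < v.1 + 1)
    (hv2 : (v.2 : ℝ) < t * ((v.2 + (n + 1) : ℕ) : ℝ))
    (h : verPassage (shiftWeights v w) (m + 1) n < horPassage (shiftWeights v w) m (n + 1))
    {π : ℕ → ℕ × ℕ} (hπ : IsGeodesic w (v.1 + (m + 1)) (v.2 + (n + 1)) π) :
    Misses (v.1 + (m + 1)) (v.2 + (n + 1)) π (square S
      (t * ((v.1 + (m + 1) : ℕ) : ℝ), t * ((v.2 + (n + 1) : ℕ) : ℝ))) := by
  rintro k hk ⟨⟨-, hx⟩, ⟨hy, -⟩⟩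
  simp only at hx hy
  have hx1 : (π k).1 ≤ v.1 := by
    have : ((π k).1 : ℝ) < v.1 + 1 := by linarith
    have : (π k).1 < v.1 + 1 := by exact_mod_cast this
    omega
  have hy1 : v.2 < (π k).2 := by
    have : (v.2 : ℝ) < (π k).2 := by linarith
    exact_mod_cast this
  -- A path visiting the square is above v and not to its right, so on the way to the endpoint it
  -- meets the vertical axis through v strictly above v.
  have key : ∃ k' ≤ v.1 + (m + 1) + (v.2 + (n + 1)), (π k').1 = v.1 ∧ v.2 < (π k').2 := by
    rcases hx1.eq_or_lt with hx2 | hx2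
    · exact ⟨k, hk, hx2, hy1⟩
    obtain ⟨k', hk', ⟨h1, -⟩, h3⟩ := hπ.1.exists_entry (p := v.1) (q := 0) (by omega) (by omega)
    have hkk : k ≤ k' := by
      by_contra! hcon
      have := (hπ.1.mono hcon.le hk).1
      omega
    have hmono := (hπ.1.mono hkk hk').2
    rcases h3 with h3 | h3
    · exact ⟨k', hk', h3, by omega⟩
    · omega
  obtain ⟨k', hk', h1, h2⟩ := key
  obtain ⟨i, hi⟩ := Nat.exists_eq_add_of_le (Nat.succ_le_of_lt h2)
  have := hπ.horPassage_le_verPassage (k₀ := k') (i := i) hk'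
    (Prod.ext h1 (by simp only; omega))
  linarith

/-- Lower bound for the probability that all geodesics miss the square. -/
lemma exists_le_measure_everyGeodesicMisses (ρ : ℝ) (hρ0 : 0 < ρ) (hρ1 : ρ < 1) :
    ∃ δ ε : ℝ, 0 < δ ∧ 0 < ε ∧ ∀ t : ℝ, 0 < t → t < 1 →
      ∃ N₀ : ℝ, ∀ (Ω : Type*) [MeasurableSpace Ω] (P : Measure Ω) [IsProbabilityMeasure P]
        (w : ℕ × ℕ → Ω → ℝ), IsWeightFamily P ρ w → ∀ N : ℝ, N₀ ≤ N →
          ε ≤ P.real (everyGeodesicMisses w ρ N t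
            (δ * (1 - t) ^ (2 / 3 : ℝ) * N ^ (2 / 3 : ℝ))) := by
  have hc : 0 < 1 - ρ := by linarith
  obtain ⟨ε, η₀, hε, hη₀, hmain⟩ := exists_le_measure_verPassage_lt hc (by linarith)
  -- The side of the square is S = X^(2/3) with X = (1-t)N. All dependence on t is absorbed in X, so
  -- ε does not depend on t.
  refine ⟨1, ε, one_pos, hε, fun t ht0 ht1 => ?_⟩
  have h1t : 0 < 1 - t := by linarith
  set η₁ := min η₀ ((1 - ρ) ^ 2 / 2) with hη₁
  have hη₁0 : 0 < η₁ := by positivity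
  -- The first entry gives n ≥ 1, so ⌈tn⌉ ≥ 1. The others make X at least 2 and large enough for η =
  -- X^(-1/3) to be admissible.
  refine ⟨max (1 / ρ ^ 2) (max (1 / η₁ ^ 3) 2 / (1 - t)), ?_⟩
  intro Ω _ P _ w hw N hN
  obtain ⟨hN1, hN2⟩ := max_le_iff.1 hN
  have hN0 : 0 < N := lt_of_lt_of_le (by positivity) hN1
  rw [div_le_iff₀ h1t] at hN2
  obtain ⟨hN3, hN4⟩ := max_le_iff.1 hN2
  obtain ⟨X, hX⟩ : ∃ X, X = N * (1 - t) := ⟨_, rfl⟩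
  rw [← hX] at hN3 hN4
  have hX0 : 0 < X := by linarith
  obtain ⟨η, hη⟩ : ∃ η : ℝ, η = X ^ (-(1 / 3) : ℝ) := ⟨_, rfl⟩
  have hη0 : 0 < η := by rw [hη]; positivity
  have hη3 : 1 / η ^ 3 = X := by
    rw [hη, ← Real.rpow_natCast, ← Real.rpow_mul hX0.le, one_div, ← Real.rpow_neg hX0.le]
    norm_num
  have hη2 : 1 / η ^ 2 = X ^ (2 / 3 : ℝ) := by
    rw [hη, ← Real.rpow_natCast, ← Real.rpow_mul hX0.le, one_div, ← Real.rpow_neg hX0.le]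
    norm_num
  have hηle : η ≤ η₁ := by
    rw [← hη3, one_div_le_one_div (by positivity) (by positivity)] at hN3
    exact le_of_pow_le_pow_left₀ (by norm_num) hη₁0.le hN3
  have hS : 1 * (1 - t) ^ (2 / 3 : ℝ) * N ^ (2 / 3 : ℝ) = 1 / η ^ 2 := by
    rw [hη2, hX, Real.mul_rpow hN0.le h1t.le]
    ring
  rw [hS]
  obtain ⟨S, hSd⟩ : ∃ S, S = 1 / η ^ 2 := ⟨_, rfl⟩
  rw [← hSd]
  have hS0 : 0 < S := by rw [hSd]; positivity
  have hSX : 2 * S ≤ X * (1 - ρ) ^ 2 := by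
    have h1 : S = X * η := by rw [hSd, ← hη3]; field_simp
    have h2 : 2 * η ≤ (1 - ρ) ^ 2 := by
      have := hηle.trans (min_le_right _ _)
      linarith
    calc 2 * S = X * (2 * η) := by rw [h1]; ring
      _ ≤ _ := by gcongr
  have hS1 : 1 < S := by
    rw [hSd, hη2]
    exact Real.one_lt_rpow (by linarith) (by norm_num)
  obtain ⟨m, hm⟩ : ∃ m, m = endX ρ N := ⟨_, rfl⟩
  obtain ⟨n, hn⟩ : ∃ n, n = endY ρ N := ⟨_, rfl⟩
  have hm1 : (m : ℝ) ≤ N * (1 - ρ) ^ 2 := by rw [hm]; exact Nat.floor_le (by positivity)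
  have hm2 : N * (1 - ρ) ^ 2 < m + 1 := by rw [hm]; exact Nat.lt_floor_add_one _
  have hn1 : (n : ℝ) ≤ N * ρ ^ 2 := by rw [hn]; exact Nat.floor_le (by positivity)
  have hn2 : N * ρ ^ 2 < n + 1 := by rw [hn]; exact Nat.lt_floor_add_one _
  have hn0 : 1 ≤ n := by
    rw [hn]
    refine Nat.le_floor ?_
    rw [div_le_iff₀ (by positivity)] at hN1
    simpa using hN1
  have hXm1 : (1 - t) * m ≤ X * (1 - ρ) ^ 2 := by
    calc _ ≤ (1 - t) * (N * (1 - ρ) ^ 2) := by gcongr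
      _ = _ := by rw [hX]; ring
  have hXm2 : X * (1 - ρ) ^ 2 - 1 ≤ (1 - t) * m := by
    have h1 : (1 - t) * (N * (1 - ρ) ^ 2) ≤ (1 - t) * (m + 1) := by gcongr
    have h2 : (1 - t) * (N * (1 - ρ) ^ 2) = X * (1 - ρ) ^ 2 := by rw [hX]; ring
    linarith
  have hXn1 : (1 - t) * n ≤ X * ρ ^ 2 := by
    calc _ ≤ (1 - t) * (N * ρ ^ 2) := by gcongr
      _ = _ := by rw [hX]; ring
  have hXn2 : X * ρ ^ 2 - 1 ≤ (1 - t) * n := by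
    have h1 : (1 - t) * (N * ρ ^ 2) ≤ (1 - t) * (n + 1) := by gcongr
    have h2 : (1 - t) * (N * ρ ^ 2) = X * ρ ^ 2 := by rw [hX]; ring
    linarith
  have hu1 : (⌊t * m + S⌋₊ : ℝ) ≤ t * m + S := Nat.floor_le (by positivity)
  have hu1' : t * m + S < ⌊t * m + S⌋₊ + 1 := Nat.lt_floor_add_one _
  have hu2 : t * n ≤ ⌈t * n⌉₊ := Nat.le_ceil _
  have hu2' : (⌈t * n⌉₊ : ℝ) < t * n + 1 := Nat.ceil_lt_add_one (by positivity)
  have hu3 : 0 < ⌈t * n⌉₊ := Nat.ceil_pos.2 (by positivity)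
  have hu4 : ⌈t * n⌉₊ ≤ n := Nat.ceil_le.2 (mul_le_of_le_one_left (by positivity) ht1.le)
  obtain ⟨a, ha⟩ : ∃ a, a = ⌊t * m + S⌋₊ := ⟨_, rfl⟩
  -- The corner sits one row below ⌈tn⌉, hence strictly below the square.
  obtain ⟨b, hb⟩ : ∃ b, ⌈t * n⌉₊ = b + 1 := ⟨_, (Nat.succ_pred_eq_of_pos hu3).symm⟩
  rw [← ha] at hu1 hu1'
  rw [hb] at hu2 hu2' hu4
  have ham : a + 1 ≤ m := by
    have : (a : ℝ) < m := by linarith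
    exact_mod_cast this
  obtain ⟨m', hm'⟩ : ∃ m', m = a + (m' + 1) := ⟨m - (a + 1), by omega⟩
  obtain ⟨n', hn'⟩ : ∃ n', n = b + (n' + 1) := ⟨n - (b + 1), by omega⟩
  have hmr : (m : ℝ) = a + ((m' + 1 : ℕ) : ℝ) := by exact_mod_cast hm'
  have hnr : (n : ℝ) = b + ((n' + 1 : ℕ) : ℝ) := by exact_mod_cast hn'
  push_cast at hu2 hu2'
  have hfam : IsExpFamily P (boundaryRate (1 - ρ) (1 - (1 - ρ))) w := by
    rw [sub_sub_cancel]
    exact hw.isExpFamily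
  have hbound := hmain η hη0 (hηle.trans (min_le_left _ _)) m' n'
    (by rw [hη3, ← hSd]; linarith) (by rw [hη3, ← hSd]; linarith)
    (by rw [hη3, sub_sub_cancel]; linarith) (by rw [hη3, sub_sub_cancel]; linarith)
    Ω P _ (hfam.shiftWeights hc (by linarith) (by ring) (a, b))
  have hsub : {ω | verPassage (fun x => shiftWeights (a, b) (fun y => w y ω) x) (m' + 1) n' <
      horPassage (fun x => shiftWeights (a, b) (fun y => w y ω) x) m' (n' + 1)} ⊆
      everyGeodesicMisses w ρ N t S := by
    intro ω hω π hπ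
    rw [← hm, ← hn] at hπ ⊢
    rw [hm'] at hu1'
    have hu5 : (b : ℝ) < t * n := by linarith
    rw [hn'] at hu5
    rw [hm', hn'] at hπ ⊢
    exact misses_of_verPassage_lt (v := (a, b)) hu1' hu5 hω hπ
  exact (ENNReal.ofReal_le_iff_le_toReal (measure_ne_top _ _)).1 (hbound.trans (measure_mono hsub))

end StationaryCGM

theorem mainTheorem3 (ρ : ℝ) (hρ0 : 0 < ρ) (hρ1 : ρ < 1) :
    (∃ C : ℝ, 0 < C ∧
      ∀ (Ω : Type*) [MeasurableSpace Ω] (P : Measure Ω) [IsProbabilityMeasure P]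
        (w : ℕ × ℕ → Ω → ℝ), StationaryCGM.IsWeightFamily P ρ w →
        ∀ δ : ℝ, 0 < δ → δ < 1 →
        ∀ r : ℝ, 1 ≤ r → ∀ N : ℝ, 1 / δ ≤ N →
        ∀ t : ℝ, 0 ≤ t → t ≤ 1 - δ →
          P.real (StationaryCGM.someGeodesicMisses w ρ N t (r * N ^ (2 / 3 : ℝ))) ≤ C / r ^ 3) ∧
    (∃ δ ε : ℝ, 0 < δ ∧ 0 < ε ∧
      ∀ t : ℝ, 0 < t → t < 1 →
      ∃ N₀ : ℝ, ∀ (Ω : Type*) [MeasurableSpace Ω] (P : Measure Ω) [IsProbabilityMeasure P]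
        (w : ℕ × ℕ → Ω → ℝ), StationaryCGM.IsWeightFamily P ρ w →
        ∀ N : ℝ, N₀ ≤ N →
          ε ≤ P.real (StationaryCGM.everyGeodesicMisses w ρ N t
            (δ * (1 - t) ^ (2 / 3 : ℝ) * N ^ (2 / 3 : ℝ)))) :=
  ⟨StationaryCGM.measure_someGeodesicMisses_le ρ hρ0 hρ1,
    StationaryCGM.exists_le_measure_everyGeodesicMisses ρ hρ0 hρ1⟩
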